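/- **Setting.** Let $\mathbb{D}$ be an infinite set (the data domain). Alphabets are finite sets; $\varepsilon$ is the empty word. *Data words and class automata.* A data word over an alphabet $\Sigma$ is a pair $(w,\pi)$ with $w=w_1\cdots w_n\in\Sigma^*$, $n\ge 1$, and $\pi:\{1,\dots,n\}\to\mathbb{D}$. Its classes are the sets $\{i \mid \pi(i)=d\}$ for the values $d$ that occur in $\pi$. For $w'\in\Gamma^*$ of length $n$ and $X\subseteq\{1,\dots,n\}$, let $w'\otimes X\in(\Gamma\times\{0,1\})^*$ be obtained from $w'$ by replacing $w'_i$ with $(w'_i,1)$ if $i\in X$ and with $(w'_i,0)$ otherwise. A class automaton over $\Sigma$ is a pair $(\mathcal{A},\mathcal{B})$ of a nondeterministic finite-state letter-to-letter transducer $\mathcal{A}:\Sigma^*\to\Gamma^*$ and a finite automaton $\mathcal{B}$ over $\Gamma\times\{0,1\}$. It accepts $(w,\pi)$ iff some accepting run of $\mathcal{A}$ on $w$ outputs a word $w'$ such that $w'\otimes X\in\mathcal{L}(\mathcal{B})$ for each class $X$ of $(w,\pi)$. *Priority class condition.* Let $\mathcal{B}$ be a deterministic complete finite automaton over $\Gamma\times\{0,1\}$.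 Its graph $G_0$ consists of the arcs labelled by letters of $\Gamma\times\{0\}$. A state is $0$-cyclic if its strongly connected component in $G_0$ contains at least one arc. A state is $(\gamma,0)$-cyclic if it lies on a cycle all of whose arcs are labelled $(\gamma,0)$, and $(\gamma,0)$-acyclic otherwise. A $((\gamma,0),(\gamma',0))$-pattern in $\mathcal{B}$ is a tuple of states $(q_1,q_2,q_3,q_4)$ such that $q_1\xrightarrow{(\gamma,0)}q_2$, $q_3$ is reachable from $q_2$ in $G_0$, $q_3\xrightarrow{(\gamma',0)}q_4$, $q_1$ is $0$-cyclic, and $q_3$ is $(\gamma',0)$-acyclic. $\mathcal{B}$ is a $0$-priority finite automaton if $\Gamma$ can be ordered as $\gamma_1\dots\gamma_n$ so that there is no $((\gamma_i,0),(\gamma_j,0))$-pattern with $i\ge j$ in $\mathcal{B}$. A language over $\Gamma\times\{0,1\}$ is $0$-priority regular if it is accepted by a $0$-priority finite automaton over $\Gamma\times\{0,1\}$. A class automaton $(\mathcal{A},\mathcal{B})$ with output alphabet $\Gamma$ has priority class condition (is a PCA) if, for some $k\ge 1$, $\Gamma$ is the union of pairwise disjoint subsets $\Gamma_1,\dots,\Gamma_k$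 and $\mathcal{L}(\mathcal{B})=L_1\cup\dots\cup L_k$, where each $L_i\subseteq(\Gamma_i\times\{0,1\})^*$ is $0$-priority regular over the alphabet $\Gamma_i\times\{0,1\}$. *Projections.* For $prj:\Sigma\to\Sigma'\cup\{\varepsilon\}$, the projection of a data word $(w,\pi)$ is the word $prj(w_1)\cdots prj(w_{|w|})\in\Sigma'^*$, and the projection of a data language is the set of projections of its elements. *Priority multicounter automata.* A PMA over $\Sigma'$ is a tuple $(Q,\Sigma',k,\delta,q_0,F)$ with a finite state set $Q$, $k\in\mathbb{N}$ counters, an initial state $q_0\in Q$, accepting states $F\subseteq Q$, and $\delta\subseteq Q\times(\Sigma'\cup\{\varepsilon\})\times\{inc_i,dec_i,ifz_{\le i}\mid 1\le i\le k\}\times Q$. The counters hold natural numbers, initially all $0$. The instruction $inc_i$ adds $1$ to counter $i$; $dec_i$ requires counter $i$ to be positive and subtracts $1$ from it; $ifz_{\le i}$ requires counters $1,\dots,i$ all to be $0$ and changes nothing. A word over $\Sigma'$ is accepted iff it is the concatenation of the letters read along some finite run (possibly without transitions) from $q_0$ to a state in $F$, with any final counter values. **Theorem.** For every alphabet $\Sigma'$,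 the following two classes of languages over $\Sigma'$ are equal: 1. the projections, under maps $prj:\Sigma\to\Sigma'\cup\{\varepsilon\}$ with $\Sigma$ an arbitrary alphabet, of data languages over $\Sigma$ and $\mathbb{D}$ accepted by PCAs; 2. the languages accepted by PMAs over $\Sigma'$. -/

import Mathlib

universe u v

namespace PriorityClass

section ZeroPriority

variable {G : Type u} {Q : Type v}

/-- The arcs of the graph `G₀` of a deterministic complete automaton over `G × {0,1}`: there is an
arc from `p` to `q` when some letter `(γ, 0)` leads from `p` to `q`.
(The tag `0` is `false`, the tag `1` is `true`.) -/
def ZeroStep (B : DFA (G × Bool) Q) (p q : Q) : Prop :=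
  ∃ γ : G, B.step p (γ, false) = q

/-- Reachability in the graph `G₀` (by paths that may be empty). -/
def ZeroReach (B : DFA (G × Bool) Q) : Q → Q → Prop :=
  Relation.ReflTransGen (ZeroStep B)

/-- `q` is `0`-cyclic: its strongly connected component in `G₀` contains at least one arc, that is,
there is a path with at least one arc from `q` to itself in `G₀`. -/
def ZeroCyclic (B : DFA (G × Bool) Q) (q : Q) : Prop :=
  Relation.TransGen (ZeroStep B) q q

/-- `q` is `(γ, 0)`-cyclic: it lies on a cycle of the functional graph of the letter `(γ, 0)`. -/
def LetterCyclic (B : DFA (G × Bool) Q) (γ : G) (q : Q) : Prop :=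
  q ∈ Function.periodicPts (fun p => B.step p (γ, false))

/-- There is a `((γ₁, 0), (γ₂, 0))`-pattern `(q₁, q₂, q₃, q₄)` in `B`. -/
def HasPattern (B : DFA (G × Bool) Q) (γ₁ γ₂ : G) : Prop :=
  ∃ q₁ q₂ q₃ q₄ : Q,
    B.step q₁ (γ₁, false) = q₂ ∧ ZeroReach B q₂ q₃ ∧ B.step q₃ (γ₂, false) = q₄ ∧
      ZeroCyclic B q₁ ∧ ¬ LetterCyclic B γ₂ q₃

/-- `B` is a `0`-priority finite automaton: the letters of `G` can be listed, each exactly once, as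
`γ₁ γ₂ … γₙ` so that there is no `((γᵢ, 0), (γⱼ, 0))`-pattern with `i ≥ j` in `B`. (Mathlib's `DFA`
is deterministic and complete; finiteness of the state set is asked for where this is used.) -/
def IsZeroPriority (B : DFA (G × Bool) Q) : Prop :=
  ∃ (n : ℕ) (e : Fin n ≃ G), ∀ i j : Fin n, j ≤ i → ¬ HasPattern B (e i) (e j)

/-- `L` is a `0`-priority regular language over `G × {0,1}`. -/
def IsZeroPriorityRegular (L : Language (G × Bool)) : Prop :=
  ∃ (P : Type) (_ : Finite P) (B : DFA (G × Bool) P), IsZeroPriority B ∧ B.accepts = L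

end ZeroPriority

/-- A nondeterministic letter-to-letter transducer with input alphabet `S`, output alphabet `G` and
state set `Q`. -/
structure Transducer (S : Type u) (G Q : Type) where
  trans : Set (Q × S × G × Q)
  start : Q
  accept : Set Q

/-- `A.Produces p w w'`: some run of `A` that begins in the state `p` and ends in an accepting state
reads `w` and writes `w'`. -/
def Transducer.Produces {S : Type u} {G Q : Type} (A : Transducer S G Q) :
    Q → List S → List G → Prop
  | p, [], [] => p ∈ A.accept
  | p, a :: w, γ :: w' => ∃ q, (p, a, γ, q) ∈ A.trans ∧ A.Produces q w w'
  | _, _, _ => False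

/-- A class automaton over the tag alphabet `S`: a letter-to-letter transducer from `S` to a finite
alphabet `Out`, and a finite automaton over `Out × {0,1}`, the class condition. -/
structure ClassAutomaton (S : Type u) where
  Out : Type
  finite_out : Finite Out
  TState : Type
  finite_tstate : Finite TState
  transducer : Transducer S Out TState
  CState : Type
  finite_cstate : Finite CState
  classCond : NFA (Out × Bool) CState

open Classical in
/-- The word `w ⊗ X`, where `X` is the class of the data value `d`, that is, the set of positions
at which the sequence `π` of data values has the value `d`: the `i`-th letter of `w` is tagged with
`1` if `πᵢ = d`, and with `0` otherwise. (Used for `w` and `π` of the same length.) -/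
noncomputable def classString {G : Type u} {D : Type v} (w : List G) (π : List D) (d : D) :
    List (G × Bool) :=
  List.zipWith (fun γ e => (γ, decide (e = d))) w π

namespace ClassAutomaton

variable {S : Type u}

/-- The data language accepted by a class automaton. A data word is a nonempty sequence of pairs of
a tag and a data value. Its classes are those of the data values that occur in it. -/
def dataLanguage (C : ClassAutomaton S) (D : Type v) : Set (List (S × D)) :=
  {u | u ≠ [] ∧ ∃ w' : List C.Out,
    C.transducer.Produces C.transducer.start (u.map Prod.fst) w' ∧
      ∀ d ∈ u.map Prod.snd, classString w' (u.map Prod.snd) d ∈ C.classCond.accepts}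

/-- The priority class condition: the alphabet `Out` is the union of `k ≥ 1` pairwise disjoint
subsets `Γᵢ`, and the language of the class condition is the union of `0`-priority regular languages
`Lᵢ` over the alphabets `Γᵢ × {0,1}`. -/
def IsPCA (C : ClassAutomaton S) : Prop :=
  ∃ (k : ℕ) (Γ : Fin k → Set C.Out) (L : ∀ i, Language (Γ i × Bool)),
    1 ≤ k ∧ Pairwise (fun i j => Disjoint (Γ i) (Γ j)) ∧ (⋃ i, Γ i) = Set.univ ∧
      (∀ i, IsZeroPriorityRegular (L i)) ∧
      C.classCond.accepts = ⨆ i, Language.map (Prod.map Subtype.val id) (L i)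

end ClassAutomaton

/-- The projection of a data word under `prj : S → A ∪ {ε}`, with `none` for `ε`. -/
def projectWord {S : Type u} {A : Type v} {D : Type*} (prj : S → Option A)
    (u : List (S × D)) : List A :=
  (u.map Prod.fst).filterMap prj

/-- The instructions for `k` counters with prefix zero tests. -/
inductive Instr (k : ℕ) where
  | inc (i : Fin k)
  | dec (i : Fin k)
  | ifzLE (i : Fin k)

/-- The instruction can change the counter values `c` into `c'`. -/
def Instr.Exec {k : ℕ} : Instr k → (Fin k → ℕ) → (Fin k → ℕ) → Prop
  | .inc i, c, c' => c' i = c i + 1 ∧ ∀ j, j ≠ i → c' j = c j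
  | .dec i, c, c' => 0 < c i ∧ c' i = c i - 1 ∧ ∀ j, j ≠ i → c' j = c j
  | .ifzLE i, c, c' => (∀ j, j ≤ i → c j = 0) ∧ ∀ j, c' j = c j

/-- A priority multicounter automaton over the alphabet `A`. In a transition, `none` is `ε`. -/
structure PMA (A : Type u) where
  State : Type
  finite_state : Finite State
  k : ℕ
  trans : Set (State × Option A × Instr k × State)
  start : State
  accept : Set State

namespace PMA

variable {A : Type u}

/-- The configuration `y` is an immediate successor of `x` induced by `σ` and `l`. -/
def Step (M : PMA A) (x : M.State × (Fin M.k → ℕ)) (σ : Option A) (l : Instr M.k)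
    (y : M.State × (Fin M.k → ℕ)) : Prop :=
  (x.1, σ, l, y.1) ∈ M.trans ∧ l.Exec x.2 y.2

/-- `M.Run x w y`: there is a sequence of steps from `x` to `y` whose labels spell `w`. -/
inductive Run (M : PMA A) :
    M.State × (Fin M.k → ℕ) → List A → M.State × (Fin M.k → ℕ) → Prop
  | refl (x : M.State × (Fin M.k → ℕ)) : Run M x [] x
  | step {x y z : M.State × (Fin M.k → ℕ)} {σ : Option A} {l : Instr M.k} {w : List A} :
      M.Step x σ l y → Run M y w z → Run M x (σ.toList ++ w) z

/-- The language accepted by `M`: runs begin in the initial state with all counters zero and end in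
an accepting state, with any counter values. -/
def language (M : PMA A) : Language A :=
  {w | ∃ (q : M.State) (c : Fin M.k → ℕ), q ∈ M.accept ∧ M.Run (M.start, fun _ => 0) w (q, c)}

end PMA

/-- The languages over `A` that are projections of data languages (over some finite tag alphabet and
the data domain `D`) accepted by class automata with priority class condition. -/
def pcaProjections (A : Type u) (D : Type v) : Set (Language A) :=
  {L | ∃ (S : Type) (_ : Finite S) (C : ClassAutomaton S) (prj : S → Option A),
    C.IsPCA ∧ L = projectWord prj '' C.dataLanguage D}

/-- The languages over `A` that are accepted by priority multicounter automata. -/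
def pmaLanguages (A : Type u) : Set (Language A) :=
  {L | ∃ M : PMA A, L = M.language}

end PriorityClass

/-! Data values can be eliminated. All values not met so far share one state of the class automaton,
so a data word matters only through that common state and the multiset of states of the classes met
so far. At each position one class, old or new, reads its letter with tag 1, and all others read it
with tag 0 (`ClassRun`, `classRun_iff`). Since all classes share the same output word, a PCA
language is a finite union over the parts of the alphabet (`projections_eq_iSup`), and one
`0`-priority automaton can be treated at a time.

From PCAs to PMAs, counters store the multiset. Each counter has a label in the finite control, the
state for which its units stand; reading a letter with tag 0 updates the labels and leaves the
counters alone. Changing labels in any other way is allowed only for counters that a zero test or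
the control knows to be empty. This makes the simulation sound for all choices (`sim_sound`). For
completeness, two things must stay bounded or available. (a) States that are not `0`-cyclic are held
in the control. Each letter brings at most one new class, and the number of states reachable from
such a state drops at each step, so at most as many are held as there are states. (b) Labels must
not run out: after relabelling, each state that has to be stored needs a counter with that label.
Give the letters ranks such that every pattern strictly increases rank. After a letter of rank `r`,
a `0`-cyclic state is settled for all ranks up to `r`: such letters act cyclically from then on, so
they lose no label (`ZeroCyclic.settled_step`, `Settled.exists_step_eq`). A class of level `m` sits
in a counter whose priority is the next rank `j > m` to occur, guessed by the machine. When a letter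
of rank `r` is read, all classes of level below `r` move to level `r`. The counters of priority at
most `r` are then empty, because a class of level `m ≥ r` sits at a priority above `m`. A prefix
zero test confirms this, and the emptied levels are labelled afresh (`SimInv.letter`).

From PMAs to PCAs, a data value is one unit of a counter: it appears at its increment and again at
its decrement, and a zero test rejects while a unit of a tested counter is alive (`unitDFA`).
Ranking the tests by the length of the tested prefix excludes the forbidden patterns
(`unitDFA_testRank_lt`). -/

namespace PriorityClass

/-! ### Eliminating data values -/

section ClassRuns

variable {S A D : Type*} {G P Q : Type*}

/-- The classes of a data word with output `w`, seen through the multiset `X` of the states of the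
classes met so far and the common state `v` of all other data values, can be completed so that all
classes end in accepting states. -/
def ClassRun (B : DFA (G × Bool) P) : P → Multiset P → List G → Prop
  | _, X, [] => ∀ q ∈ X, q ∈ B.accept
  | v, X, γ :: w => ∃ q Y, (q = v ∧ Y = X ∨ X = q ::ₘ Y) ∧
      ClassRun B (B.step v (γ, false))
        (B.step q (γ, true) ::ₘ Y.map fun p => B.step p (γ, false)) w

open Classical in
theorem classString_cons (γ : G) (w : List G) (e : D) (π : List D) (d : D) :
    classString (γ :: w) (e :: π) d = (γ, decide (e = d)) :: classString w π d := rfl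

open Classical in
-- The induction needs a start in the middle of a word: `F` is the set of values met so far and `s`
-- gives their states. Infinity of `D` guarantees that a new value is always available.
theorem classRun_iff [Infinite D] (B : DFA (G × Bool) P) (w : List G) :
    ∀ (F : Finset D) (s : D → P) (v : P), (∀ d ∉ F, s d = v) →
      (ClassRun B v (F.val.map s) w ↔ ∃ π : List D, π.length = w.length ∧
        ∀ d, d ∈ F ∨ d ∈ π → B.evalFrom (s d) (classString w π d) ∈ B.accept) := by
  induction w with
  | nil =>
    intro F s v hs
    constructor
    · intro h
      refine ⟨[], rfl, fun d hd => ?_⟩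
      simp only [List.not_mem_nil, or_false] at hd
      exact h _ (Multiset.mem_map_of_mem s hd)
    · rintro ⟨π, hπ, h⟩ q hq
      obtain ⟨d, hd, rfl⟩ := Multiset.mem_map.1 hq
      obtain rfl := List.length_eq_zero_iff.1 hπ
      exact h d (Or.inl hd)
  | cons γ w ih =>
    intro F s v hs
    let s' : D → D → P := fun e d => B.step (s d) (γ, decide (e = d))
    have key : ∀ e, ((insert e F).val.map (s' e)) =
        B.step (s e) (γ, true) ::ₘ
          ((F.erase e).val.map s).map fun p => B.step p (γ, false) := by
      intro e
      have h1 : insert e F = insert e (F.erase e) := by ext x; by_cases h : x = e <;> simp [h]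
      rw [h1, Finset.insert_val_of_notMem (Finset.notMem_erase e F), Multiset.map_cons,
        Multiset.map_map]
      congr 1
      · simp [s']
      · refine Multiset.map_congr rfl fun x hx => ?_
        have : e ≠ x := fun h => by subst h; exact Finset.notMem_erase e F hx
        simp [s', this]
    have hs' : ∀ e, ∀ d ∉ insert e F, s' e d = B.step v (γ, false) := by
      intro e d hd
      simp only [Finset.mem_insert, not_or] at hd
      have : e ≠ d := fun h => hd.1 h.symm
      simp [s', this, hs d hd.2]
    have main : ∀ e, ClassRun B (B.step v (γ, false)) (B.step (s e) (γ, true) ::ₘ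
          ((F.erase e).val.map s).map fun p => B.step p (γ, false)) w ↔
        ∃ π : List D, π.length = w.length ∧ ∀ d, d ∈ F ∨ d ∈ e :: π →
          B.evalFrom (s d) (classString (γ :: w) (e :: π) d) ∈ B.accept := by
      intro e
      rw [← key, ih _ _ _ (hs' e)]
      refine exists_congr fun π => and_congr_right fun _ => forall_congr' fun d => ?_
      rw [classString_cons, DFA.evalFrom_cons]
      refine imp_congr ?_ Iff.rfl
      simp only [Finset.mem_insert, List.mem_cons]
      tauto
    constructor
    · rintro ⟨q, Y, h, hrun⟩
      -- The value at this position: one outside `F` if a new class is opened, otherwise a value in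
      -- `F` whose state is `q`. Erasing `e` from `F` covers both cases uniformly.
      obtain ⟨e, rfl, rfl⟩ : ∃ e, q = s e ∧ Y = (F.erase e).val.map s := by
        rcases h with ⟨rfl, rfl⟩ | h
        · obtain ⟨e, he⟩ := Infinite.exists_notMem_finset F
          exact ⟨e, (hs e he).symm, by rw [Finset.erase_eq_of_notMem he]⟩
        · have : q ∈ F.val.map s := by rw [h]; exact Multiset.mem_cons_self q Y
          obtain ⟨e, he, rfl⟩ := Multiset.mem_map.1 this
          refine ⟨e, rfl, ?_⟩
          rw [← Multiset.cons_erase he, Multiset.map_cons, Multiset.cons_inj_right] at h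
          rw [← h, Finset.erase_val]
      obtain ⟨π, hπ, hacc⟩ := (main e).1 hrun
      exact ⟨e :: π, by simp [hπ], hacc⟩
    · rintro ⟨π, hπ, hacc⟩
      cases π with
      | nil => simp at hπ
      | cons e π =>
        refine ⟨s e, (F.erase e).val.map s, ?_, (main e).2 ⟨π, by simpa using hπ, hacc⟩⟩
        by_cases he : e ∈ F
        · right
          rw [Finset.erase_val, ← Multiset.map_cons, Multiset.cons_erase he]
        · left
          exact ⟨hs e he, by rw [Finset.erase_eq_of_notMem he]⟩

theorem Transducer.Produces.length_eq {S : Type*} {G Q : Type} {T : Transducer S G Q} :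
    ∀ {w : List S} {w' : List G} {p : Q}, T.Produces p w w' → w'.length = w.length
  | [], [], _, _ => rfl
  | [], _ :: _, _, h => by simp [Transducer.Produces] at h
  | _ :: _, [], _, h => by simp [Transducer.Produces] at h
  | _ :: _, _ :: _, _, h => by
    obtain ⟨q, -, hq⟩ := h
    simp [hq.length_eq]

/-- The projections of the data words for which `T` has an output such that all classes are
accepted by `B`, described without data values. -/
def classLanguage {G Q P : Type} (T : Transducer S G Q) (B : DFA (G × Bool) P)
    (prj : S → Option A) : Language A :=
  {u | ∃ w w', w ≠ [] ∧ T.Produces T.start w w' ∧ ClassRun B B.start 0 w' ∧ w.filterMap prj = u}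

theorem mem_classLanguage_iff [Infinite D] {G Q P : Type} (T : Transducer S G Q)
    (B : DFA (G × Bool) P) (prj : S → Option A) (x : List A) :
    x ∈ classLanguage T B prj ↔ ∃ u : List (S × D), u ≠ [] ∧ (∃ w' : List G,
      T.Produces T.start (u.map Prod.fst) w' ∧
        ∀ d ∈ u.map Prod.snd, classString w' (u.map Prod.snd) d ∈ B.accepts) ∧
      projectWord prj u = x := by
  have key (w' : List G) := classRun_iff (D := D) B w' ∅ (fun _ => B.start) B.start (by simp)
  simp only [Finset.empty_val, Multiset.map_zero] at key
  constructor
  · rintro ⟨w, w', hw, hT, hB, rfl⟩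
    obtain ⟨π, hπ, h⟩ := (key w').1 hB
    have hl : w.length = π.length := by rw [hπ, hT.length_eq]
    refine ⟨w.zip π, ?_, ⟨w', ?_, ?_⟩, ?_⟩
    · intro h0
      have := congrArg List.length h0
      rw [List.length_zip, ← hl] at this
      simp only [min_self, List.length_nil, List.length_eq_zero_iff] at this
      exact hw this
    · rwa [List.map_fst_zip hl.le]
    · rw [List.map_snd_zip hl.ge]
      intro d hd
      exact h d (Or.inr hd)
    · rw [projectWord, List.map_fst_zip hl.le]
  · rintro ⟨u, hu, ⟨w', hT, h⟩, rfl⟩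
    refine ⟨u.map Prod.fst, w', by simpa using hu, hT, (key w').2 ⟨u.map Prod.snd, ?_, ?_⟩, rfl⟩
    · rw [hT.length_eq, List.length_map, List.length_map]
    · intro d hd
      exact h d (by simpa using hd)

end ClassRuns

/-! ### Splitting a priority class condition into its parts -/

section Splitting

/-- The transducer `T` with outputs restricted to the letters in `Γ`. -/
def Transducer.restrict {S : Type*} {G Q : Type} (T : Transducer S G Q) (Γ : Set G) :
    Transducer S Γ Q where
  trans := {t | (t.1, t.2.1, (t.2.2.1 : G), t.2.2.2) ∈ T.trans}
  start := T.start
  accept := T.accept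

theorem Transducer.produces_restrict {S : Type*} {G Q : Type} (T : Transducer S G Q) (Γ : Set G) :
    ∀ (w : List S) (w' : List Γ) (p : Q),
      (T.restrict Γ).Produces p w w' ↔ T.Produces p w (w'.map Subtype.val)
  | [], [], _ => Iff.rfl
  | [], _ :: _, _ => by simp [Transducer.Produces]
  | _ :: _, [], _ => by simp [Transducer.Produces]
  | a :: w, γ :: w', p => by
    simp only [Transducer.Produces, List.map_cons, Transducer.produces_restrict T Γ w w']
    rfl

theorem map_classString {D : Type*} {G H : Type*} (f : G → H) (d : D) :
    ∀ (w : List G) (π : List D), (classString w π d).map (Prod.map f id) =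
      classString (w.map f) π d
  | [], _ => by simp [classString]
  | _ :: _, [] => by simp [classString]
  | γ :: w, e :: π => by
    have := map_classString f d w π
    simp only [classString] at this
    simp [classString, this]

theorem map_fst_classString {D : Type*} {G : Type*} (d : D) :
    ∀ (w : List G) (π : List D), w.length = π.length → (classString w π d).map Prod.fst = w
  | [], _, _ => by simp [classString]
  | _ :: _, [], h => by simp at h
  | γ :: w, e :: π, h => by
    have := map_fst_classString d w π (by simpa using h)
    simp only [classString] at this
    simp [classString, this]

/-- All class strings of a data word carry the same output word, which is nonempty. Its first letter
lies in only one `Γ i`, so the languages accepting the different classes must all have the same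
index. -/
theorem projections_eq_iSup {S : Type} {A D : Type*} [Infinite D] (C : ClassAutomaton S)
    (prj : S → Option A) {k : ℕ} {Γ : Fin k → Set C.Out} {P : Fin k → Type}
    (B : ∀ i, DFA (Γ i × Bool) (P i)) (hdisj : Pairwise fun i j => Disjoint (Γ i) (Γ j))
    (hC : C.classCond.accepts = ⨆ i, Language.map (Prod.map Subtype.val id) (B i).accepts) :
    projectWord prj '' C.dataLanguage D =
      ⨆ i, classLanguage (C.transducer.restrict (Γ i)) (B i) prj := by
  have hmem : ∀ x, x ∈ C.classCond.accepts ↔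
      ∃ i, ∃ y ∈ (B i).accepts, y.map (Prod.map Subtype.val id) = x := by
    intro x
    rw [hC, Language.mem_iSup]
    rfl
  refine Set.ext fun x => Iff.trans ?_ Language.mem_iSup.symm
  simp only [mem_classLanguage_iff (D := D), Transducer.produces_restrict]
  constructor
  · rintro ⟨u, ⟨hu, w', hT, h⟩, rfl⟩
    have hl : w'.length = (u.map Prod.snd).length := by
      rw [hT.length_eq, List.length_map, List.length_map]
    obtain ⟨⟨a, d₀⟩, u', rfl⟩ := List.exists_cons_of_ne_nil hu
    obtain ⟨γ, w₀, rfl⟩ : ∃ γ w₀, w' = γ :: w₀ := by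
      cases w' with
      | nil => simp at hl
      | cons γ w₀ => exact ⟨γ, w₀, rfl⟩
    have hfst : ∀ (i : Fin k) (y : List (Γ i × Bool)) (d : D),
        y.map (Prod.map Subtype.val id) = classString (γ :: w₀) (((a, d₀) :: u').map Prod.snd) d →
        (y.map Prod.fst).map Subtype.val = γ :: w₀ := by
      intro i y d hy
      rw [← map_fst_classString d (γ :: w₀) _ hl, ← hy]
      simp
    obtain ⟨i, y, -, hy'⟩ := (hmem _).1 (h d₀ (by simp))
    have hi := hfst i y d₀ hy'
    have hγi : γ ∈ Γ i := by
      have : γ ∈ (y.map Prod.fst).map Subtype.val := by rw [hi]; simp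
      obtain ⟨g, -, rfl⟩ := List.mem_map.1 this
      exact g.2
    refine ⟨i, (a, d₀) :: u', hu, ⟨y.map Prod.fst, by rwa [hi], fun d hd => ?_⟩, rfl⟩
    obtain ⟨j, z, hz, hz'⟩ := (hmem _).1 (h d hd)
    have hj := hfst j z d hz'
    have hγj : γ ∈ Γ j := by
      have : γ ∈ (z.map Prod.fst).map Subtype.val := by rw [hj]; simp
      obtain ⟨g, -, rfl⟩ := List.mem_map.1 this
      exact g.2
    obtain rfl : i = j := by
      by_contra hij
      exact Set.disjoint_left.1 (hdisj hij) hγi hγj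
    have : z = classString (y.map Prod.fst) (((a, d₀) :: u').map Prod.snd) d := by
      have hinj : Function.Injective (List.map (Prod.map Subtype.val id :
          Γ i × Bool → C.Out × Bool)) :=
        List.map_injective_iff.2 (Subtype.val_injective.prodMap Function.injective_id)
      apply hinj
      rw [hz', map_classString, hi]
    rwa [← this]
  · rintro ⟨i, u, hu, ⟨w', hT, h⟩, rfl⟩
    refine ⟨u, ⟨hu, w'.map Subtype.val, hT, fun d hd => ?_⟩, rfl⟩
    exact (hmem _).2 ⟨i, _, h d hd, map_classString _ _ _ _⟩

end Splitting

/-! ### Labelled runs and simulations between them -/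

section LabelledRuns

variable {A X Y : Type*}

/-- Runs of a labelled transition relation, with the word spelled by their labels. -/
inductive LRun (step : X → Option A → X → Prop) : X → List A → X → Prop
  | refl (x : X) : LRun step x [] x
  | head {x y z : X} {σ : Option A} {w : List A} :
      step x σ y → LRun step y w z → LRun step x (σ.toList ++ w) z

theorem LRun.trans {step : X → Option A → X → Prop} {x y z : X} {u w : List A}
    (h₁ : LRun step x u y) (h₂ : LRun step y w z) : LRun step x (u ++ w) z := by
  induction h₁ with
  | refl x => exact h₂
  | head h _ ih => rw [List.append_assoc]; exact .head h (ih h₂)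

theorem LRun.single {step : X → Option A → X → Prop} {x y : X} {σ : Option A}
    (h : step x σ y) : LRun step x σ.toList y := by
  simpa using LRun.head h (.refl y)

theorem LRun.simulate {step : X → Option A → X → Prop} {step' : Y → Option A → Y → Prop}
    (R : X → Y → Prop)
    (hR : ∀ x y, R x y → ∀ σ x', step x σ x' → ∃ y', step' y σ y' ∧ R x' y')
    {x x' : X} {w : List A} (h : LRun step x w x') {y : Y} (hxy : R x y) :
    ∃ y', LRun step' y w y' ∧ R x' y' := by
  induction h generalizing y with
  | refl x => exact ⟨y, .refl y, hxy⟩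
  | head hs _ ih =>
    obtain ⟨y₁, h₁, hR₁⟩ := hR _ _ hxy _ _ hs
    obtain ⟨y₂, h₂, hR₂⟩ := ih hR₁
    exact ⟨y₂, .head h₁ h₂, hR₂⟩

theorem PMA.run_iff {A : Type u} (M : PMA A) (x y : M.State × (Fin M.k → ℕ)) (w : List A) :
    M.Run x w y ↔ LRun (fun x σ y => ∃ l, M.Step x σ l y) x w y := by
  constructor
  · intro h
    induction h with
    | refl x => exact .refl x
    | step h _ ih => exact .head ⟨_, h⟩ ih
  · intro h
    induction h with
    | refl x => exact .refl x
    | head h _ ih =>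
      obtain ⟨l, h⟩ := h
      exact .step h ih

end LabelledRuns

/-! ### Counter machines with priorities, and their reduction to PMAs -/

section Machines

/-- Instructions for counters indexed by `K`; `test r` asks that all counters of priority less than
`r` be zero. -/
inductive CounterOp (K : Type) where
  | inc (k : K)
  | dec (k : K)
  | test (r : ℕ)

/-- `c'` is `c` with the counter `k` incremented. -/
def IncAt {K : Type} (k : K) (c c' : K → ℕ) : Prop :=
  c' k = c k + 1 ∧ ∀ j, j ≠ k → c' j = c j

open Classical in
theorem incAt_update {K : Type} (k : K) (c : K → ℕ) :
    IncAt k c (Function.update c k (c k + 1)) :=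
  ⟨by simp, fun j hj => by simp [hj]⟩

open Classical in
theorem incAt_update_pred {K : Type} (k : K) (c : K → ℕ) (h : c k ≠ 0) :
    IncAt k (Function.update c k (c k - 1)) c :=
  ⟨by simp; omega, fun j hj => by simp [hj]⟩

/-- The instruction can change the counter values `c` into `c'`. -/
def CounterOp.Exec {K : Type} (pr : K → ℕ) : CounterOp K → (K → ℕ) → (K → ℕ) → Prop
  | .inc k, c, c' => IncAt k c c'
  | .dec k, c, c' => IncAt k c' c
  | .test r, c, c' => c' = c ∧ ∀ k, pr k < r → c k = 0

/-- Renaming of the counters of an instruction. -/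
def CounterOp.map {K K' : Type} (f : K → K') : CounterOp K → CounterOp K'
  | .inc k => .inc (f k)
  | .dec k => .dec (f k)
  | .test r => .test r

/-- Multicounter automata whose zero tests are governed by priorities of the counters. -/
structure Machine (A : Type u) where
  St : Type
  finite_st : Finite St
  K : Type
  finite_k : Finite K
  pr : K → ℕ
  step : St → Option A → CounterOp K → St → Prop
  start : St
  accept : Set St

namespace Machine

variable {A : Type u}

/-- Steps between configurations. -/
def Step (M : Machine A) (x : M.St × (M.K → ℕ)) (σ : Option A) (y : M.St × (M.K → ℕ)) : Prop :=
  ∃ op, M.step x.1 σ op y.1 ∧ op.Exec M.pr x.2 y.2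

/-- The words spelled by runs from the start, with all counters zero, to an accepting state. -/
def language (M : Machine A) : Language A :=
  {w | ∃ s c, s ∈ M.accept ∧ LRun M.Step (M.start, 0) w (s, c)}

end Machine

/-- A finite type can be listed in nondecreasing order of any rank. -/
theorem exists_equiv_fin_monotone {K : Type*} [Finite K] (pr : K → ℕ) :
    ∃ (n : ℕ) (e : Fin n ≃ K), Monotone (pr ∘ e) := by
  obtain ⟨n, ⟨e⟩⟩ := Finite.exists_equiv_fin K
  refine ⟨n, (Tuple.sort (pr ∘ e.symm)).trans e.symm, ?_⟩
  exact Tuple.monotone_sort (pr ∘ e.symm)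

/-- The instruction on `n + 1` counters, the least of which is always zero, that corresponds to an
instruction on counters listed by `e`. -/
def CounterOp.Corr {K : Type} {n : ℕ} (pr : K → ℕ) (e : Fin n ≃ K) :
    CounterOp K → Instr (n + 1) → Prop
  | .inc k, l => l = .inc (e.symm k).succ
  | .dec k, l => l = .dec (e.symm k).succ
  | .test r, l => ∃ i, l = .ifzLE i ∧ ∀ x : Fin n, x.succ ≤ i ↔ pr (e x) < r

theorem CounterOp.exists_corr {K : Type} {n : ℕ} (pr : K → ℕ) (e : Fin n ≃ K)
    (he : Monotone (pr ∘ e)) (op : CounterOp K) : ∃ l, op.Corr pr e l := by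
  cases op with
  | inc k => exact ⟨_, rfl⟩
  | dec k => exact ⟨_, rfl⟩
  | test r =>
    -- A PMA test always includes at least one counter, whereas `test r` may concern none. The
    -- additional counter `0`, which is never changed, makes the set nonempty; monotonicity of `pr ∘
    -- e` makes it an initial segment.
    let s : Finset (Fin (n + 1)) := insert 0 ((Finset.univ.filter fun x => pr (e x) < r).image
      Fin.succ)
    have hs : s.Nonempty := ⟨0, by simp [s]⟩
    refine ⟨_, s.max' hs, rfl, fun x => ⟨fun h => ?_, fun h => ?_⟩⟩
    · have hm := s.max'_mem hs
      rcases Finset.mem_insert.1 hm with h0 | h1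
      · rw [h0] at h
        simp at h
      · obtain ⟨y, hy, hy'⟩ := Finset.mem_image.1 h1
        rw [← hy'] at h
        exact lt_of_le_of_lt (he (Fin.succ_le_succ_iff.1 h)) (Finset.mem_filter.1 hy).2
    · exact s.le_max' _ (by simp [s, h])

theorem CounterOp.Corr.exec {K : Type} {n : ℕ} {pr : K → ℕ} {e : Fin n ≃ K} {op : CounterOp K}
    {l : Instr (n + 1)} (h : op.Corr pr e l) {c c' : K → ℕ} (hc : op.Exec pr c c') :
    l.Exec (Fin.cons 0 (c ∘ e)) (Fin.cons 0 (c' ∘ e)) := by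
  cases op with
  | inc k =>
    cases h
    refine ⟨by simpa using hc.1, fun j hj => ?_⟩
    cases j using Fin.cases with
    | zero => rfl
    | succ j => simpa using hc.2 (e j) (fun h => hj (by simp [← h]))
  | dec k =>
    cases h
    refine ⟨by simp [hc.1], by simp [hc.1], fun j hj => ?_⟩
    cases j using Fin.cases with
    | zero => rfl
    | succ j => simpa using (hc.2 (e j) (fun h => hj (by simp [← h]))).symm
  | test r =>
    obtain ⟨i, rfl, hi⟩ := h
    obtain ⟨rfl, h0⟩ := hc
    refine ⟨fun j hj => ?_, fun j => rfl⟩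
    cases j using Fin.cases with
    | zero => rfl
    | succ j => simpa using h0 _ ((hi j).1 hj)

theorem CounterOp.Corr.exec_inv {K : Type} {n : ℕ} {pr : K → ℕ} {e : Fin n ≃ K}
    {op : CounterOp K} {l : Instr (n + 1)} (h : op.Corr pr e l) {c : K → ℕ}
    {d : Fin (n + 1) → ℕ} (hc : l.Exec (Fin.cons 0 (c ∘ e)) d) :
    ∃ c', d = Fin.cons 0 (c' ∘ e) ∧ op.Exec pr c c' := by
  have hd : d 0 = 0 → d = Fin.cons 0 ((fun k => d (e.symm k).succ) ∘ e) := by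
    intro h0
    funext j
    cases j using Fin.cases with
    | zero => simpa using h0
    | succ j => simp
  have hne : ∀ {j k : K}, j ≠ k → (e.symm j).succ ≠ (e.symm k).succ := by
    intro j k hjk h
    exact hjk (by simpa using h)
  cases op with
  | inc k =>
    cases h
    refine ⟨_, hd (by simpa using hc.2 0 (Fin.succ_ne_zero _).symm), ?_⟩
    exact ⟨by simpa using hc.1, fun j hj => by simpa using hc.2 _ (hne hj)⟩
  | dec k =>
    cases h
    refine ⟨_, hd (by simpa using hc.2.2 0 (Fin.succ_ne_zero _).symm), ?_⟩
    have h1 := hc.1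
    have h2 := hc.2.1
    simp only [Fin.cons_succ, Function.comp_apply, Equiv.apply_symm_apply] at h1 h2
    exact ⟨show c k = d _ + 1 by omega, fun j hj => by simpa using (hc.2.2 _ (hne hj)).symm⟩
  | test r =>
    obtain ⟨i, rfl, hi⟩ := h
    refine ⟨c, funext hc.2, rfl, fun k hk => ?_⟩
    simpa using hc.1 (e.symm k).succ ((hi _).2 (by simpa using hk))

theorem Machine.language_mem_pmaLanguages {A : Type u} (M : Machine A) :
    M.language ∈ pmaLanguages A := by
  have := M.finite_k
  obtain ⟨n, e, he⟩ := exists_equiv_fin_monotone M.pr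
  let N : PMA A :=
    { State := M.St
      finite_state := M.finite_st
      k := n + 1
      trans := {t | ∃ op, M.step t.1 t.2.1 op t.2.2.2 ∧ op.Corr M.pr e t.2.2.1}
      start := M.start
      accept := M.accept }
  let R : M.St × (M.K → ℕ) → N.State × (Fin N.k → ℕ) → Prop := fun x y =>
    y.1 = x.1 ∧ y.2 = (Fin.cons 0 (x.2 ∘ e) : Fin (n + 1) → ℕ)
  have h0 : R (M.start, 0) (N.start, fun _ => 0) := by
    refine ⟨rfl, funext fun j => ?_⟩
    cases j using Fin.cases <;> rfl
  refine ⟨N, Set.Subset.antisymm ?_ ?_⟩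
  · rintro w ⟨s, c, hs, hrun⟩
    obtain ⟨⟨s', d⟩, hrun', h1, -⟩ := hrun.simulate
      (step' := fun x σ y => ∃ l, N.Step x σ l y) R (by
        rintro ⟨x, c⟩ ⟨y, d⟩ ⟨h1, h2⟩ σ ⟨x', c'⟩ ⟨op, hstep, hex⟩
        cases h1
        cases h2
        obtain ⟨l, hl⟩ := CounterOp.exists_corr M.pr e he op
        exact ⟨(x', Fin.cons 0 (c' ∘ e)), ⟨l, ⟨op, hstep, hl⟩, hl.exec hex⟩, rfl, rfl⟩) h0
    cases h1
    exact ⟨_, d, hs, (N.run_iff _ _ _).2 hrun'⟩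
  · rintro w ⟨s, d, hs, hrun⟩
    obtain ⟨⟨s', c⟩, hrun', h1, -⟩ := ((N.run_iff _ _ _).1 hrun).simulate
      (step' := M.Step) (fun y x => R x y) (by
        rintro ⟨y, d⟩ ⟨x, c⟩ ⟨h1, h2⟩ σ ⟨y', d'⟩ ⟨l, ⟨op, hstep, hl⟩, hex⟩
        cases h1
        cases h2
        obtain ⟨c', rfl, hc'⟩ := hl.exec_inv hex
        exact ⟨(y', c'), ⟨op, hstep, hc'⟩, rfl, rfl⟩) h0
    cases h1
    exact ⟨_, c, hs, hrun'⟩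

/-- The languages of machines with prioritized counters. -/
def machineLanguages (A : Type u) : Set (Language A) :=
  Set.range Machine.language

theorem bot_mem_machineLanguages (A : Type u) : (⊥ : Language A) ∈ machineLanguages A := by
  refine ⟨⟨Unit, inferInstance, Empty, inferInstance, nofun, fun _ _ _ _ => False, (), ∅⟩, ?_⟩
  ext w
  simp only [Machine.language, Set.mem_empty_iff_false, false_and, exists_false]
  rfl

namespace Machine

variable {A : Type u}

/-- The transitions of the machine that chooses one of two machines and runs it. -/
inductive SumStep (M₁ M₂ : Machine A) :
    Option (M₁.St ⊕ M₂.St) → Option A → CounterOp (M₁.K ⊕ M₂.K) → Option (M₁.St ⊕ M₂.St) → Prop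
  | startl : SumStep M₁ M₂ none none (.test 0) (some (.inl M₁.start))
  | startr : SumStep M₁ M₂ none none (.test 0) (some (.inr M₂.start))
  | left {s s' σ op} : M₁.step s σ op s' →
      SumStep M₁ M₂ (some (.inl s)) σ (op.map .inl) (some (.inl s'))
  | right {s s' σ op} : M₂.step s σ op s' →
      SumStep M₁ M₂ (some (.inr s)) σ (op.map .inr) (some (.inr s'))

/-- The machine that chooses one of two machines and runs it. -/
def sum (M₁ M₂ : Machine A) : Machine A where
  St := Option (M₁.St ⊕ M₂.St)
  finite_st := by
    have := M₁.finite_st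
    have := M₂.finite_st
    infer_instance
  K := M₁.K ⊕ M₂.K
  finite_k := by
    have := M₁.finite_k
    have := M₂.finite_k
    infer_instance
  pr := Sum.elim M₁.pr M₂.pr
  step := SumStep M₁ M₂
  start := none
  accept := {s | (∃ x ∈ M₁.accept, s = some (.inl x)) ∨ ∃ x ∈ M₂.accept, s = some (.inr x)}

/-- A test in the sum also concerns the counters of the other machine. These remain zero, so the
test is no stronger than in the machine that is running. -/
theorem exec_inl {K₁ K₂ : Type} {pr₁ : K₁ → ℕ} {pr₂ : K₂ → ℕ} {op : CounterOp K₁} {c : K₁ → ℕ}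
    {d : K₁ ⊕ K₂ → ℕ} :
    (op.map .inl).Exec (Sum.elim pr₁ pr₂) (Sum.elim c (fun _ => 0)) d ↔
      ∃ c', d = Sum.elim c' (fun _ => 0) ∧ op.Exec pr₁ c c' := by
  constructor
  · intro h
    cases op with
    | inc k =>
      refine ⟨d ∘ .inl, ?_, h.1, fun j hj => h.2 _ (by simpa using hj)⟩
      funext j
      rcases j with j | j
      · rfl
      · exact h.2 (.inr j) (by simp)
    | dec k =>
      refine ⟨d ∘ .inl, ?_, h.1, fun j hj => h.2 (.inl j) (by simpa using hj)⟩
      funext j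
      rcases j with j | j
      · rfl
      · exact (h.2 (.inr j) (by simp)).symm
    | test r => exact ⟨c, h.1, rfl, fun k hk => h.2 (.inl k) hk⟩
  · rintro ⟨c', rfl, h⟩
    cases op with
    | inc k =>
      refine ⟨h.1, fun j hj => ?_⟩
      rcases j with j | j
      · exact h.2 j (by simpa using hj)
      · rfl
    | dec k =>
      refine ⟨h.1, fun j hj => ?_⟩
      rcases j with j | j
      · exact h.2 j (by simpa using hj)
      · rfl
    | test r =>
      obtain ⟨rfl, h⟩ := h
      refine ⟨rfl, fun j hj => ?_⟩
      rcases j with j | j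
      · exact h j hj
      · rfl

theorem exec_inr {K₁ K₂ : Type} {pr₁ : K₁ → ℕ} {pr₂ : K₂ → ℕ} {op : CounterOp K₂} {c : K₂ → ℕ}
    {d : K₁ ⊕ K₂ → ℕ} :
    (op.map .inr).Exec (Sum.elim pr₁ pr₂) (Sum.elim (fun _ => 0) c) d ↔
      ∃ c', d = Sum.elim (fun _ => 0) c' ∧ op.Exec pr₂ c c' := by
  constructor
  · intro h
    cases op with
    | inc k =>
      refine ⟨d ∘ .inr, ?_, h.1, fun j hj => h.2 _ (by simpa using hj)⟩
      funext j
      rcases j with j | j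
      · exact h.2 (.inl j) (by simp)
      · rfl
    | dec k =>
      refine ⟨d ∘ .inr, ?_, h.1, fun j hj => h.2 (.inr j) (by simpa using hj)⟩
      funext j
      rcases j with j | j
      · exact (h.2 (.inl j) (by simp)).symm
      · rfl
    | test r => exact ⟨c, h.1, rfl, fun k hk => h.2 (.inr k) hk⟩
  · rintro ⟨c', rfl, h⟩
    cases op with
    | inc k =>
      refine ⟨h.1, fun j hj => ?_⟩
      rcases j with j | j
      · rfl
      · exact h.2 j (by simpa using hj)
    | dec k =>
      refine ⟨h.1, fun j hj => ?_⟩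
      rcases j with j | j
      · rfl
      · exact h.2 j (by simpa using hj)
    | test r =>
      obtain ⟨rfl, h⟩ := h
      refine ⟨rfl, fun j hj => ?_⟩
      rcases j with j | j
      · rfl
      · exact h j hj

theorem sum_run_inl (M₁ M₂ : Machine A) {s : M₁.St} {c : M₁.K → ℕ} {w : List A}
    {y : (M₁.sum M₂).St × ((M₁.sum M₂).K → ℕ)} :
    LRun (M₁.sum M₂).Step (some (.inl s), Sum.elim c (fun _ => 0)) w y ↔
      ∃ s' c', y = (some (.inl s'), Sum.elim c' (fun _ => 0)) ∧ LRun M₁.Step (s, c) w (s', c') := by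
  let R : (M₁.sum M₂).St × ((M₁.sum M₂).K → ℕ) → M₁.St × (M₁.K → ℕ) → Prop := fun y x =>
    y = (some (.inl x.1), Sum.elim x.2 (fun _ => 0))
  constructor
  · intro h
    obtain ⟨⟨s', c'⟩, h1, h2⟩ := h.simulate (step' := M₁.Step) R (by
      rintro _ ⟨s, c⟩ rfl σ ⟨y, d⟩ ⟨op, hs, hex⟩
      cases hs with
      | left hs =>
        obtain ⟨c', rfl, h⟩ := exec_inl.1 hex
        exact ⟨(_, c'), ⟨_, hs, h⟩, rfl⟩) (y := (s, c)) rfl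
    exact ⟨s', c', h2, h1⟩
  · rintro ⟨s', c', rfl, h⟩
    obtain ⟨_, h1, rfl⟩ := h.simulate (step' := (M₁.sum M₂).Step) (fun x y => R y x) (by
      rintro ⟨s, c⟩ _ rfl σ ⟨s', c'⟩ ⟨op, hs, hex⟩
      exact ⟨(some (.inl s'), _), ⟨_, SumStep.left hs, exec_inl.2 ⟨c', rfl, hex⟩⟩, rfl⟩) rfl
    exact h1

theorem sum_run_inr (M₁ M₂ : Machine A) {s : M₂.St} {c : M₂.K → ℕ} {w : List A}
    {y : (M₁.sum M₂).St × ((M₁.sum M₂).K → ℕ)} :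
    LRun (M₁.sum M₂).Step (some (.inr s), Sum.elim (fun _ => 0) c) w y ↔
      ∃ s' c', y = (some (.inr s'), Sum.elim (fun _ => 0) c') ∧ LRun M₂.Step (s, c) w (s', c') := by
  let R : (M₁.sum M₂).St × ((M₁.sum M₂).K → ℕ) → M₂.St × (M₂.K → ℕ) → Prop := fun y x =>
    y = (some (.inr x.1), Sum.elim (fun _ => 0) x.2)
  constructor
  · intro h
    obtain ⟨⟨s', c'⟩, h1, h2⟩ := h.simulate (step' := M₂.Step) R (by
      rintro _ ⟨s, c⟩ rfl σ ⟨y, d⟩ ⟨op, hs, hex⟩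
      cases hs with
      | right hs =>
        obtain ⟨c', rfl, h⟩ := exec_inr.1 hex
        exact ⟨(_, c'), ⟨_, hs, h⟩, rfl⟩) (y := (s, c)) rfl
    exact ⟨s', c', h2, h1⟩
  · rintro ⟨s', c', rfl, h⟩
    obtain ⟨_, h1, rfl⟩ := h.simulate (step' := (M₁.sum M₂).Step) (fun x y => R y x) (by
      rintro ⟨s, c⟩ _ rfl σ ⟨s', c'⟩ ⟨op, hs, hex⟩
      exact ⟨(some (.inr s'), _), ⟨_, SumStep.right hs, exec_inr.2 ⟨c', rfl, hex⟩⟩, rfl⟩) rfl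
    exact h1

theorem language_sum (M₁ M₂ : Machine A) :
    (M₁.sum M₂).language = M₁.language ⊔ M₂.language := by
  have hl : (0 : M₁.K ⊕ M₂.K → ℕ) = Sum.elim (fun _ => 0) (fun _ => 0) := by
    funext j
    rcases j with j | j <;> rfl
  refine Set.Subset.antisymm ?_ (Set.union_subset ?_ ?_)
  · rintro w ⟨s, c, hs, hrun⟩
    cases hrun with
    | refl => rcases hs with ⟨x, -, hx⟩ | ⟨x, -, hx⟩ <;> cases hx
    | @head _ y _ σ w hst hrun =>
      obtain ⟨y, d⟩ := y
      obtain ⟨op, hst, hex⟩ := hst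
      cases hst with
      | startl =>
        left
        obtain ⟨rfl, -⟩ := hex
        change LRun _ (_, (0 : M₁.K ⊕ M₂.K → ℕ)) _ _ at hrun
        rw [hl] at hrun
        obtain ⟨s', c', h, h'⟩ := (sum_run_inl M₁ M₂).1 hrun
        cases h
        refine ⟨s', c', ?_, h'⟩
        rcases hs with ⟨x, hx, hx'⟩ | ⟨x, -, hx⟩
        · cases hx'; exact hx
        · cases hx
      | startr =>
        right
        obtain ⟨rfl, -⟩ := hex
        change LRun _ (_, (0 : M₁.K ⊕ M₂.K → ℕ)) _ _ at hrun
        rw [hl] at hrun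
        obtain ⟨s', c', h, h'⟩ := (sum_run_inr M₁ M₂).1 hrun
        cases h
        refine ⟨s', c', ?_, h'⟩
        rcases hs with ⟨x, -, hx⟩ | ⟨x, hx, hx'⟩
        · cases hx
        · cases hx'; exact hx
  · rintro w ⟨s, c, hs, hrun⟩
    refine ⟨some (.inl s), Sum.elim c (fun _ => 0), Or.inl ⟨s, hs, rfl⟩, ?_⟩
    have h : (M₁.sum M₂).Step ((M₁.sum M₂).start, 0) none
        ((some (.inl M₁.start) : Option (M₁.St ⊕ M₂.St)), 0) :=
      ⟨.test 0, SumStep.startl (M₁ := M₁) (M₂ := M₂), rfl,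
        fun k hk => absurd hk (Nat.not_lt_zero _)⟩
    refine LRun.head (σ := none) h ?_
    change LRun _ (_, (0 : M₁.K ⊕ M₂.K → ℕ)) _ _
    rw [hl]
    exact (sum_run_inl M₁ M₂).2 ⟨s, c, rfl, hrun⟩
  · rintro w ⟨s, c, hs, hrun⟩
    refine ⟨some (.inr s), Sum.elim (fun _ => 0) c, Or.inr ⟨s, hs, rfl⟩, ?_⟩
    have h : (M₁.sum M₂).Step ((M₁.sum M₂).start, 0) none
        ((some (.inr M₂.start) : Option (M₁.St ⊕ M₂.St)), 0) :=
      ⟨.test 0, SumStep.startr (M₁ := M₁) (M₂ := M₂), rfl,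
        fun k hk => absurd hk (Nat.not_lt_zero _)⟩
    refine LRun.head (σ := none) h ?_
    change LRun _ (_, (0 : M₁.K ⊕ M₂.K → ℕ)) _ _
    rw [hl]
    exact (sum_run_inr M₁ M₂).2 ⟨s, c, rfl, hrun⟩

end Machine

/-- The union is taken among machines, where a disjoint sum of counter sets needs no renumbering;
counters are listed in order of priority only at the end. -/
theorem iSup_mem_pmaLanguages {A : Type u} {k : ℕ} (L : Fin k → Language A)
    (hL : ∀ i, L i ∈ machineLanguages A) : ⨆ i, L i ∈ pmaLanguages A := by
  have : ⨆ i, L i ∈ machineLanguages A := by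
    rw [← Finset.sup_univ_eq_iSup]
    refine Finset.sup_induction (p := (· ∈ machineLanguages A)) (bot_mem_machineLanguages A) ?_
      fun i _ => hL i
    rintro _ ⟨M₁, rfl⟩ _ ⟨M₂, rfl⟩
    exact ⟨M₁.sum M₂, M₁.language_sum M₂⟩
  obtain ⟨M, hM⟩ := this
  rw [← hM]
  exact M.language_mem_pmaLanguages

end Machines

/-! ### Multisets of states represented by labelled counters -/

section Tokens

variable {K P : Type} [Fintype K]

/-- The multiset of states represented by counters `c`, when a unit of the counter `k` stands for
the state `L k`. -/
def tokens (L : K → Option P) (c : K → ℕ) : Multiset P :=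
  ∑ k, c k • (L k).elim 0 fun q => {q}

theorem tokens_incAt {L : K → Option P} {c c' : K → ℕ} {k : K} {q : P} (h : IncAt k c c')
    (hq : L k = some q) : tokens L c' = q ::ₘ tokens L c := by
  classical
  unfold tokens
  rw [← Finset.add_sum_erase _ _ (Finset.mem_univ k),
    ← Finset.add_sum_erase Finset.univ (fun k => c k • (L k).elim 0 fun q => ({q} : Multiset P))
      (Finset.mem_univ k), h.1, hq, add_smul, one_smul, ← Multiset.singleton_add]
  have : ∑ x ∈ Finset.univ.erase k, c' x • (L x).elim 0 (fun q => ({q} : Multiset P)) =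
      ∑ x ∈ Finset.univ.erase k, c x • (L x).elim 0 (fun q => ({q} : Multiset P)) :=
    Finset.sum_congr rfl fun x hx => by rw [h.2 x (Finset.ne_of_mem_erase hx)]
  rw [this]
  simp only [Option.elim]
  abel

theorem tokens_congr {L L' : K → Option P} {c : K → ℕ} (h : ∀ k, c k ≠ 0 → L k = L' k) :
    tokens L c = tokens L' c := by
  refine Finset.sum_congr rfl fun k _ => ?_
  by_cases hk : c k = 0
  · simp [hk]
  · rw [h k hk]

theorem tokens_map {P' : Type} (f : P → P') (L : K → Option P) (c : K → ℕ) :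
    tokens (fun k => (L k).map f) c = (tokens L c).map f := by
  unfold tokens
  rw [← Multiset.coe_mapAddMonoidHom, map_sum]
  refine Finset.sum_congr rfl fun k _ => ?_
  rw [map_nsmul]
  beta_reduce
  cases L k <;> simp

theorem tokens_eq_zero {L : K → Option P} {c : K → ℕ} (h : ∀ k, c k = 0) : tokens L c = 0 :=
  Finset.sum_eq_zero fun k _ => by simp [h k]

theorem mem_tokens {L : K → Option P} {c : K → ℕ} {q : P} :
    q ∈ tokens L c ↔ ∃ k, c k ≠ 0 ∧ L k = some q := by
  unfold tokens
  rw [Multiset.mem_sum]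
  refine ⟨fun ⟨k, _, hk⟩ => ⟨k, ?_⟩, fun ⟨k, hk, hq⟩ => ⟨k, Finset.mem_univ k, ?_⟩⟩
  · obtain ⟨h0, h1⟩ := Multiset.mem_nsmul.1 hk
    refine ⟨h0, ?_⟩
    cases hL : L k with
    | none => simp [hL] at h1
    | some p =>
      rw [hL] at h1
      rw [Multiset.mem_singleton.1 h1]
  · rw [Multiset.mem_nsmul]
    exact ⟨hk, by simp [hq]⟩

end Tokens

/-! ### The simulating machine and its soundness -/

section Simulator

/-- Control states of the machine that simulates class runs: the state of the transducer (`none`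
when the input is finished), the state of the data values not met so far, the states of some
classes, and the meaning of the counters (`none` for a counter known to be zero). -/
@[ext]
structure Ctrl (Q P K : Type) where
  main : Option Q
  fresh : P
  held : Multiset P
  label : K → Option P

variable {S A : Type*} {G Q P K : Type}

/-- The moves of the machine that simulates class runs: read a letter, move a class between the
control and a counter, give a new meaning to counters known to be zero, finish the input, and remove
accepted classes. -/
inductive SimMove (T : Transducer S G Q) (B : DFA (G × Bool) P) (prj : S → Option A)
    (pr : K → ℕ) : Ctrl Q P K → Option A → CounterOp K → Ctrl Q P K → Prop
  | letter {p p' v l L a γ q Y} : (p, a, γ, p') ∈ T.trans → (q = v ∧ Y = l ∨ l = q ::ₘ Y) →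
      SimMove T B prj pr ⟨some p, v, l, L⟩ (prj a) (.test 0)
        ⟨some p', B.step v (γ, false),
          B.step q (γ, true) ::ₘ Y.map fun p => B.step p (γ, false),
          fun k => (L k).map fun p => B.step p (γ, false)⟩
  | fetch {p v l L k q} : L k = some q →
      SimMove T B prj pr ⟨p, v, l, L⟩ none (.dec k) ⟨p, v, q ::ₘ l, L⟩
  | store {p v l L k q} : L k = some q →
      SimMove T B prj pr ⟨p, v, q ::ₘ l, L⟩ none (.inc k) ⟨p, v, l, L⟩
  | reset {p v l L L' r} : (∀ k, r ≤ pr k → L k ≠ none → L' k = L k) →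
      SimMove T B prj pr ⟨p, v, l, L⟩ none (.test r) ⟨p, v, l, L'⟩
  | finish {p v l L} : p ∈ T.accept → l ≠ 0 →
      SimMove T B prj pr ⟨some p, v, l, L⟩ none (.test 0) ⟨none, v, l, L⟩
  | discard {v l L q} : q ∈ B.accept →
      SimMove T B prj pr ⟨none, v, q ::ₘ l, L⟩ none (.test 0) ⟨none, v, l, L⟩

/-- Steps between configurations with at most `b` classes in the control. -/
def SimStep (T : Transducer S G Q) (B : DFA (G × Bool) P) (prj : S → Option A)
    (pr : K → ℕ) (b : ℕ) (x : Ctrl Q P K × (K → ℕ)) (σ : Option A)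
    (y : Ctrl Q P K × (K → ℕ)) : Prop :=
  ∃ op, SimMove T B prj pr x.1 σ op y.1 ∧ op.Exec pr x.2 y.2 ∧ y.1.held.card ≤ b

/-- The held states together with the states represented by the counters form the multiset of a
class run, which is rebuilt from the end of the run backwards. Unlabelled counters are zero
throughout, so a final configuration without labels or held states has no class left. The last
clause records that the input can end only when some class exists; this makes the data word
nonempty. -/
theorem sim_sound [Fintype K] {T : Transducer S G Q} {B : DFA (G × Bool) P}
    {prj : S → Option A} {pr : K → ℕ} {b : ℕ} {x y : Ctrl Q P K × (K → ℕ)} {u : List A}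
    (h : LRun (SimStep T B prj pr b) x u y) (hm : y.1.main = none) (hh : y.1.held = 0)
    (hl : ∀ k, y.1.label k = none) (hx : ∀ k, x.1.label k = none → x.2 k = 0) :
    (x.1.main = none → u = [] ∧ ∀ q ∈ x.1.held + tokens x.1.label x.2, q ∈ B.accept) ∧
    ∀ p, x.1.main = some p → ∃ w w', w.filterMap prj = u ∧ T.Produces p w w' ∧
      ClassRun B x.1.fresh (x.1.held + tokens x.1.label x.2) w' ∧
      (w = [] → x.1.held + tokens x.1.label x.2 ≠ 0) := by
  induction h with
  | refl x =>
    refine ⟨fun _ => ⟨rfl, ?_⟩, fun p hp => by rw [hm] at hp; cases hp⟩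
    rw [hh, tokens_eq_zero fun k => hx k (hl k)]
    simp
  | @head x y z σ u hs _ ih =>
    obtain ⟨x, c⟩ := x
    obtain ⟨y, c'⟩ := y
    obtain ⟨op, hmv, hex, -⟩ := hs
    specialize ih hm hh hl
    dsimp only at hmv hex hx ih ⊢
    cases hmv with
    | @letter p p' v l L a γ q Y ht hq =>
      obtain ⟨rfl, -⟩ := hex
      obtain ⟨-, ih⟩ := ih fun k hk => hx k (by simpa using hk)
      obtain ⟨w, w', rfl, hP, hC, -⟩ := ih p' rfl
      refine ⟨nofun, fun p₀ hp₀ => ?_⟩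
      obtain rfl : p = p₀ := by simpa using hp₀
      refine ⟨a :: w, γ :: w', ?_, ⟨p', ht, hP⟩, ⟨q, Y + tokens L c', ?_, ?_⟩, nofun⟩
      · cases h : prj a <;> simp [h]
      · rcases hq with ⟨rfl, rfl⟩ | rfl
        · exact Or.inl ⟨rfl, rfl⟩
        · exact Or.inr (Multiset.cons_add _ _ _)
      · rw [tokens_map, Multiset.cons_add, ← Multiset.map_add] at hC
        exact hC
    | @fetch p v l L k q hk =>
      have h1 : q ::ₘ l + tokens L c' = l + tokens L c := by
        rw [tokens_incAt hex hk, Multiset.cons_add, Multiset.add_cons]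
      dsimp only at ih
      rw [h1] at ih
      exact ih fun j hj => by
        have : j ≠ k := fun h => by rw [h, hk] at hj; cases hj
        rw [← hex.2 j this]; exact hx j hj
    | @store p v l L k q hk =>
      have h1 : l + tokens L c' = q ::ₘ l + tokens L c := by
        rw [tokens_incAt hex hk, Multiset.cons_add, Multiset.add_cons]
      dsimp only at ih
      rw [h1] at ih
      exact ih fun j hj => by
        have : j ≠ k := fun h => by rw [h, hk] at hj; cases hj
        rw [hex.2 j this]; exact hx j hj
    | @reset p v l L L' r hL =>
      obtain ⟨rfl, h0⟩ := hex
      -- A nonzero counter has passed neither the zero test nor the absence of a label, so its label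
      -- is kept and the represented multiset is unchanged.
      have h1 : ∀ k, c' k ≠ 0 → L k = L' k := fun k hk =>
        (hL k (not_lt.1 fun h => hk (h0 k h)) fun h => hk (hx k h)).symm
      dsimp only at ih
      rw [← tokens_congr h1] at ih
      exact ih fun k hk => by
        by_contra hc
        exact hc (hx k ((h1 k hc).trans hk))
    | @finish p v l L hp hl0 =>
      obtain ⟨rfl, -⟩ := hex
      obtain ⟨rfl, h⟩ := (ih hx).1 rfl
      refine ⟨nofun, fun p₀ hp₀ => ?_⟩
      obtain rfl : p = p₀ := by simpa using hp₀
      exact ⟨[], [], rfl, hp, h, fun _ h => hl0 (add_eq_zero.1 h).1⟩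
    | @discard v l L q hq =>
      obtain ⟨rfl, -⟩ := hex
      obtain ⟨rfl, h⟩ := (ih hx).1 rfl
      refine ⟨fun _ => ⟨rfl, fun q' hq' => ?_⟩, nofun⟩
      rw [Multiset.cons_add, Multiset.mem_cons] at hq'
      rcases hq' with rfl | hq'
      · exact hq
      · exact h q' hq'

instance finite_ctrl [Finite Q] [Finite P] [Finite K] (b : ℕ) :
    Finite {x : Ctrl Q P K // x.held.card ≤ b} := by
  have h1 : Finite {l : Multiset P // l.card ≤ b} := by
    have := (List.finite_length_le P b).to_subtype
    refine Finite.of_surjective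
      (fun l : {l : List P | l.length ≤ b} => (⟨l.1, l.2⟩ :
        {l : Multiset P // l.card ≤ b})) ?_
    rintro ⟨l, hl⟩
    obtain ⟨l, rfl⟩ := Quot.exists_rep l
    exact ⟨⟨l, by simpa using hl⟩, rfl⟩
  refine Finite.of_injective (β := Option Q × P × {l : Multiset P // l.card ≤ b} × (K → Option P))
    (fun x => (x.1.main, x.1.fresh, ⟨x.1.held, x.2⟩, x.1.label)) ?_
  rintro ⟨x, hx⟩ ⟨y, hy⟩ h
  simp only [Prod.mk.injEq, Subtype.mk.injEq] at h
  exact Subtype.ext (Ctrl.ext h.1 h.2.1 h.2.2.1 h.2.2.2)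

/-- The machine that simulates class runs. -/
def simulator [Finite Q] [Finite P] [Finite K] (T : Transducer S G Q) (B : DFA (G × Bool) P)
    (prj : S → Option A) (pr : K → ℕ) (b : ℕ) : Machine A where
  St := {x : Ctrl Q P K // x.held.card ≤ b}
  finite_st := inferInstance
  K := K
  finite_k := inferInstance
  pr := pr
  step x σ op y := SimMove T B prj pr x.1 σ op y.1
  start := ⟨⟨some T.start, B.start, 0, fun _ => none⟩, by simp⟩
  accept := {x | x.1.main = none ∧ x.1.held = 0 ∧ ∀ k, x.1.label k = none}

theorem mem_simulator_language [Finite Q] [Finite P] [Finite K] (T : Transducer S G Q)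
    (B : DFA (G × Bool) P) (prj : S → Option A) (pr : K → ℕ) (b : ℕ) (u : List A) :
    u ∈ (simulator T B prj pr b).language ↔ ∃ v L c, (∀ k, L k = none) ∧
      LRun (SimStep T B prj pr b) (⟨some T.start, B.start, 0, fun _ => none⟩, 0) u
        (⟨none, v, 0, L⟩, c) := by
  let R : (simulator T B prj pr b).St × ((simulator T B prj pr b).K → ℕ) →
      Ctrl Q P K × (K → ℕ) → Prop := fun x y => y.1 = x.1.1 ∧ y.2 = x.2
  constructor
  · rintro ⟨s, c, ⟨h1, h2, h3⟩, hrun⟩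
    obtain ⟨⟨⟨p, v, l, L⟩, c'⟩, hrun', h4, -⟩ := hrun.simulate
      (step' := SimStep T B prj pr b) R (by
        rintro ⟨x, c⟩ ⟨y, d⟩ ⟨ha, hb⟩ σ ⟨x', c'⟩ ⟨op, hs, hex⟩
        cases ha
        cases hb
        exact ⟨(x'.1, c'), ⟨op, hs, hex, x'.2⟩, rfl, rfl⟩)
      (y := (⟨some T.start, B.start, 0, fun _ => none⟩, 0)) ⟨rfl, rfl⟩
    dsimp only at h4
    rw [← h4] at h1 h2 h3
    dsimp only at h1 h2 h3
    subst h1 h2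
    exact ⟨v, L, c', h3, hrun'⟩
  · rintro ⟨v, L, c, hL, hrun⟩
    obtain ⟨⟨x, c'⟩, hrun', h4, -⟩ := hrun.simulate
      (step' := (simulator T B prj pr b).Step) (fun y x => R x y) (by
        rintro ⟨y, d⟩ ⟨x, c⟩ ⟨ha, hb⟩ σ ⟨y', d'⟩ ⟨op, hs, hex, hb'⟩
        cases ha
        cases hb
        exact ⟨(⟨y', hb'⟩, d'), ⟨op, hs, hex⟩, rfl, rfl⟩)
      (y := ((simulator T B prj pr b).start, 0)) ⟨rfl, rfl⟩
    refine ⟨x, c', ?_, hrun'⟩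
    dsimp only at h4
    exact ⟨by rw [← h4], by rw [← h4], fun k => by rw [← h4]; exact hL k⟩

theorem simulator_language_le [Finite Q] [Finite P] [Finite K] (T : Transducer S G Q)
    (B : DFA (G × Bool) P) (prj : S → Option A) (pr : K → ℕ) (b : ℕ) (u : List A)
    (hu : u ∈ (simulator T B prj pr b).language) : u ∈ classLanguage T B prj := by
  have := Fintype.ofFinite K
  obtain ⟨v, L, c, hL, hrun⟩ := (mem_simulator_language T B prj pr b u).1 hu
  obtain ⟨w, w', hw, hP, hC, hne⟩ := (sim_sound hrun rfl rfl hL fun _ _ => rfl).2 _ rfl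
  have h0 : (0 : Multiset P) + tokens (fun _ : K => none) 0 = 0 := by
    rw [tokens_eq_zero (c := 0) fun _ => rfl, add_zero]
  rw [h0] at hC hne
  exact ⟨w, w', fun h => hne h rfl, hP, hC, hw⟩

end Simulator

/-! ### Cyclic and settled states in the graph of tag `0` -/

section Graph

variable {G P : Type} (B : DFA (G × Bool) P)

theorem LetterCyclic.zeroCyclic {B : DFA (G × Bool) P} {γ : G} {q : P} (h : LetterCyclic B γ q) :
    ZeroCyclic B q := by
  obtain ⟨n, hn, h⟩ := h
  have key : ∀ m q, Relation.TransGen (ZeroStep B) q ((fun p => B.step p (γ, false))^[m + 1] q) := by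
    intro m
    induction m with
    | zero => exact fun q => .single ⟨γ, rfl⟩
    | succ m ih => exact fun q => .head ⟨γ, rfl⟩ (ih _)
  have := key (n - 1) q
  rwa [Nat.sub_add_cancel hn, h] at this

/-- `q` is `0`-cyclic, and all letters of rank at most `m` act cyclically on all states that can be
reached from it. -/
def Settled (rk : G → ℕ) (m : ℕ) (q : P) : Prop :=
  ZeroCyclic B q ∧ ∀ γ, rk γ ≤ m → ∀ q', ZeroReach B q q' → LetterCyclic B γ q'

variable {B} {rk : G → ℕ}

theorem ZeroCyclic.settled {q : P} {m : ℕ} (h : ZeroCyclic B q) (hm : ∀ γ, m < rk γ) :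
    Settled B rk m q :=
  ⟨h, fun γ hγ => absurd (hm γ) (not_lt.2 hγ)⟩

theorem Settled.step {q : P} {m : ℕ} {γ : G} (h : Settled B rk m q) (hγ : rk γ ≤ m) :
    Settled B rk m (B.step q (γ, false)) := by
  have hr : ∀ q', ZeroReach B (B.step q (γ, false)) q' → ZeroReach B q q' := fun q' h' =>
    .head ⟨γ, rfl⟩ h'
  exact ⟨(h.2 γ hγ _ (hr _ .refl)).zeroCyclic, fun γ' hγ' q' hq' => h.2 γ' hγ' q' (hr _ hq')⟩

/-- The predecessor of `q` on its cycle under `(γ, 0)` is again settled. Hence updating labels by a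
letter of low rank leaves every settled state with a label. -/
theorem Settled.exists_step_eq {q : P} {m : ℕ} {γ : G} (h : Settled B rk m q) (hγ : rk γ ≤ m) :
    ∃ q', Settled B rk m q' ∧ B.step q' (γ, false) = q := by
  obtain ⟨n, hn, hq⟩ := h.2 γ hγ q .refl
  have key : ∀ i, Settled B rk m ((fun p => B.step p (γ, false))^[i] q) := by
    intro i
    induction i with
    | zero => exact h
    | succ i ih =>
      rw [Function.iterate_succ_apply']
      exact ih.step hγ
  refine ⟨_, key (n - 1), ?_⟩
  have : (fun p => B.step p (γ, false))^[n - 1 + 1] q = q := by rwa [Nat.sub_add_cancel hn]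
  rwa [Function.iterate_succ_apply'] at this

/-- A letter of rank at most `rk γ` acting acyclically on a state reachable after `γ` would complete
a pattern starting in the `0`-cyclic state `q`, against the order of ranks. This is where the
priority condition is used. -/
theorem ZeroCyclic.settled_step (hpat : ∀ γ γ', HasPattern B γ γ' → rk γ < rk γ') {q : P}
    (h : ZeroCyclic B q) (γ : G) : Settled B rk (rk γ) (B.step q (γ, false)) := by
  have key : ∀ γ', rk γ' ≤ rk γ → ∀ q', ZeroReach B (B.step q (γ, false)) q' →
      LetterCyclic B γ' q' := by
    intro γ' hγ' q' hq'
    by_contra hc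
    exact absurd (hpat γ γ' ⟨q, _, q', _, rfl, hq', rfl, h, hc⟩) (not_lt.2 hγ')
  exact ⟨(key γ le_rfl _ .refl).zeroCyclic, key⟩

variable (B) in
/-- The number of states that can be reached from `q`. -/
noncomputable def zeroHeight (q : P) : ℕ :=
  Set.ncard {q' | ZeroReach B q q'}

variable [Finite P]

theorem zeroHeight_le (q : P) : zeroHeight B q ≤ Nat.card P := by
  unfold zeroHeight
  rw [← Set.ncard_univ]
  exact Set.ncard_le_ncard (Set.subset_univ _)

theorem zeroHeight_pos (q : P) : 1 ≤ zeroHeight B q :=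
  (Set.ncard_pos (Set.toFinite _)).2 ⟨q, .refl⟩

/-- The state `q` itself cannot be reached again, so it leaves the reachable set. This bounds how
long a class can stay outside the `0`-cyclic states if it is not touched. -/
theorem zeroHeight_step_lt {q : P} (hq : ¬ ZeroCyclic B q) (γ : G) :
    zeroHeight B (B.step q (γ, false)) < zeroHeight B q := by
  refine Set.ncard_lt_ncard ⟨fun q' h => .head ⟨γ, rfl⟩ h, fun h => hq ?_⟩
  have : ZeroReach B (B.step q (γ, false)) q := h .refl
  exact .head' ⟨γ, rfl⟩ this

end Graph

/-- The first rank greater than `m` of a letter of `w`, and `top` if there is none. -/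
def nextRank {G : Type} (rk : G → ℕ) (top : ℕ) : List G → ℕ → ℕ
  | [], _ => top
  | γ :: w, m => if m < rk γ then rk γ else nextRank rk top w m

theorem nextRank_le {G : Type} {rk : G → ℕ} {top : ℕ} (h : ∀ γ, rk γ ≤ top) (m : ℕ) :
    ∀ w : List G, nextRank rk top w m ≤ top
  | [] => le_rfl
  | γ :: w => by
    rw [nextRank]
    split_ifs
    · exact h γ
    · exact nextRank_le h m w

theorem lt_nextRank {G : Type} {rk : G → ℕ} {top m : ℕ} (h : m < top) :
    ∀ w : List G, m < nextRank rk top w m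
  | [] => h
  | γ :: w => by
    rw [nextRank]
    split_ifs with h'
    · exact h'
    · exact lt_nextRank h w

/-! ### Silent moves of the simulating machine -/

section Completeness

variable {S A : Type*} {G Q P : Type}

section Moves

variable {K : Type} [Fintype K] {T : Transducer S G Q} {B : DFA (G × Bool) P}
  {prj : S → Option A} {pr : K → ℕ} {b : ℕ}

/-- The units of the counters in `Z` can be moved to counters of the same meaning outside `Z`. -/
theorem exists_run_transfer {p : Option Q} {v : P} {l : Multiset P} {L : K → Option P}
    (hl : l.card + 1 ≤ b) (Z Ok : K → Prop) (c : K → ℕ) (h1 : ∀ k, ¬ Z k → c k ≠ 0 → Ok k)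
    (h2 : ∀ k, Z k → c k ≠ 0 → ∃ q k', ¬ Z k' ∧ L k = some q ∧ L k' = some q ∧ Ok k') :
    ∃ c', LRun (SimStep T B prj pr b) (⟨p, v, l, L⟩, c) [] (⟨p, v, l, L⟩, c') ∧
      tokens L c' = tokens L c ∧ ∀ k, c' k ≠ 0 → ¬ Z k ∧ Ok k := by
  classical
  obtain ⟨n, hn⟩ : ∃ n, n = ∑ k with Z k, c k := ⟨_, rfl⟩
  induction n generalizing c with
  | zero =>
    refine ⟨c, .refl _, rfl, fun k hk => ?_⟩
    have hz : ¬ Z k := fun hz => hk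
      (Finset.sum_eq_zero_iff.1 hn.symm k (by simp [hz]))
    exact ⟨hz, h1 k hz hk⟩
  | succ n ih =>
    obtain ⟨k, hk, hck⟩ : ∃ k ∈ Finset.univ.filter Z, c k ≠ 0 :=
      Finset.exists_ne_zero_of_sum_ne_zero fun h => Nat.succ_ne_zero n (hn.trans h)
    have hZ : Z k := (Finset.mem_filter.1 hk).2
    obtain ⟨q, k', hk', hq, hq', hok⟩ := h2 k hZ hck
    have hd := incAt_update_pred k c hck
    set d := Function.update c k (c k - 1)
    have he := incAt_update k' d
    set e := Function.update d k' (d k' + 1)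
    have hkk : ∀ j, Z j → e j = d j := fun j hj => he.2 j fun h => hk' (h ▸ hj)
    have hle : ∀ j, d j ≤ c j := fun j => by
      by_cases h : j = k
      · rw [h, hd.1]; omega
      · rw [hd.2 j h]
    obtain ⟨c', hrun, htok, hc'⟩ := ih e
      (fun j hj hej => by
        by_cases hjk : j = k'
        · exact hjk ▸ hok
        · rw [he.2 j hjk] at hej
          exact h1 j hj (by have := hle j; omega))
      (fun j hj hej => by
        rw [hkk j hj] at hej
        exact h2 j hj (by have := hle j; omega))
      (by
        have h3 : ∑ j with Z j, e j = ∑ j with Z j, d j :=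
          Finset.sum_congr rfl fun j hj => hkk j (Finset.mem_filter.1 hj).2
        have h4 : ∑ j ∈ (Finset.univ.filter Z).erase k, d j =
            ∑ j ∈ (Finset.univ.filter Z).erase k, c j :=
          Finset.sum_congr rfl fun j hj => (hd.2 j (Finset.ne_of_mem_erase hj)).symm
        rw [← Finset.add_sum_erase _ _ hk, hd.1] at hn
        rw [h3, ← Finset.add_sum_erase _ _ hk, h4]
        omega)
    refine ⟨c', ?_, ?_, hc'⟩
    · have s1 : SimStep T B prj pr b (⟨p, v, l, L⟩, c) none (⟨p, v, q ::ₘ l, L⟩, d) :=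
        ⟨.dec k, .fetch hq, hd, by simpa using hl⟩
      have s2 : SimStep T B prj pr b (⟨p, v, q ::ₘ l, L⟩, d) none (⟨p, v, l, L⟩, e) :=
        ⟨.inc k', .store hq', he, by dsimp only; omega⟩
      exact .head s1 (.head s2 hrun)
    · rw [htok, tokens_incAt he hq', tokens_incAt hd hq]

/-- Held states can be stored in counters of the same meaning. -/
theorem exists_run_store {p : Option Q} {v : P} {l : Multiset P} {L : K → Option P}
    (Ok : K → Prop) (s : Multiset P) (hl : (s + l).card ≤ b) (c : K → ℕ)
    (h1 : ∀ k, c k ≠ 0 → Ok k) (h2 : ∀ q ∈ s, ∃ k, L k = some q ∧ Ok k) :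
    ∃ c', LRun (SimStep T B prj pr b) (⟨p, v, s + l, L⟩, c) [] (⟨p, v, l, L⟩, c') ∧
      tokens L c' = s + tokens L c ∧ ∀ k, c' k ≠ 0 → Ok k := by
  classical
  induction s using Multiset.induction_on generalizing c with
  | empty => exact ⟨c, by rw [zero_add]; exact .refl _, by simp, h1⟩
  | cons q s ih =>
    obtain ⟨k, hk, hok⟩ := h2 q (by simp)
    have hd := incAt_update k c
    set d := Function.update c k (c k + 1)
    rw [Multiset.cons_add, Multiset.card_cons] at hl
    obtain ⟨c', hrun, htok, hc'⟩ := ih (by omega) d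
      (fun j hj => by
        by_cases h : j = k
        · exact h ▸ hok
        · rw [hd.2 j h] at hj
          exact h1 j hj)
      (fun q' hq' => h2 q' (Multiset.mem_cons_of_mem hq'))
    refine ⟨c', ?_, ?_, hc'⟩
    · rw [Multiset.cons_add]
      have s1 : SimStep T B prj pr b (⟨p, v, q ::ₘ (s + l), L⟩, c) none (⟨p, v, s + l, L⟩, d) :=
        ⟨.inc k, .store hk, hd, by dsimp only; omega⟩
      exact .head s1 hrun
    · rw [htok, tokens_incAt hd hk, Multiset.cons_add, Multiset.add_cons]

/-- When the input is finished, accepting states can be removed. -/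
theorem exists_run_discard {v : P} {L : K → Option P} (hb : 1 ≤ b) (n : ℕ)
    (hpr : ∀ k, pr k < n) (l : Multiset P) (c : K → ℕ) (hlb : l.card ≤ b)
    (hL : ∀ k, c k ≠ 0 → L k ≠ none) (hacc : ∀ q ∈ l + tokens L c, q ∈ B.accept) :
    ∃ c' L', (∀ k, L' k = none) ∧
      LRun (SimStep T B prj pr b) (⟨none, v, l, L⟩, c) [] (⟨none, v, 0, L'⟩, c') := by
  classical
  induction l using Multiset.induction_on with
  | cons q l ih =>
    rw [Multiset.card_cons] at hlb
    obtain ⟨c', L', hL', hrun⟩ := ih (by omega) fun q' hq' => hacc q' (by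
      rw [Multiset.cons_add]
      exact Multiset.mem_cons_of_mem hq')
    have s1 : SimStep T B prj pr b (⟨none, v, q ::ₘ l, L⟩, c) none (⟨none, v, l, L⟩, c) :=
      ⟨.test 0, .discard (hacc q (by simp)), ⟨rfl, fun k hk => absurd hk (Nat.not_lt_zero _)⟩,
        by dsimp only; omega⟩
    exact ⟨c', L', hL', .head s1 hrun⟩
  | empty =>
    rw [zero_add] at hacc
    obtain ⟨m, hm⟩ : ∃ m, m = ∑ k, c k := ⟨_, rfl⟩
    induction m generalizing c with
    | zero =>
      -- All priorities are below `n`, so `test n` covers every counter, and all labels may be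
      -- dropped.
      refine ⟨c, fun _ => none, fun _ => rfl, LRun.single (σ := none) ⟨.test n, ?_, ⟨rfl, ?_⟩, ?_⟩⟩
      · exact .reset fun k hk => absurd (hpr k) (not_lt.2 hk)
      · exact fun k _ => Finset.sum_eq_zero_iff.1 hm.symm k (Finset.mem_univ k)
      · simp
    | succ m ih =>
      obtain ⟨k, -, hck⟩ : ∃ k ∈ Finset.univ, c k ≠ 0 :=
        Finset.exists_ne_zero_of_sum_ne_zero (by omega)
      obtain ⟨q, hq⟩ := Option.ne_none_iff_exists'.1 (hL k hck)
      have hd := incAt_update_pred k c hck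
      set d := Function.update c k (c k - 1)
      have htok := tokens_incAt hd hq
      have hle : ∀ j, d j ≤ c j := fun j => by
        by_cases h : j = k
        · rw [h, hd.1]; omega
        · rw [hd.2 j h]
      obtain ⟨c', L', hL', hrun⟩ := ih d (fun j hj => hL j (by have := hle j; omega))
        (fun q' hq' => hacc q' (by rw [htok]; exact Multiset.mem_cons_of_mem hq'))
        (by
          have h4 : ∑ j ∈ Finset.univ.erase k, d j = ∑ j ∈ Finset.univ.erase k, c j :=
            Finset.sum_congr rfl fun j hj => (hd.2 j (Finset.ne_of_mem_erase hj)).symm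
          rw [← Finset.add_sum_erase _ _ (Finset.mem_univ k), hd.1] at hm
          rw [← Finset.add_sum_erase _ _ (Finset.mem_univ k), h4]
          omega)
      have s1 : SimStep T B prj pr b (⟨none, v, 0, L⟩, c) none (⟨none, v, q ::ₘ 0, L⟩, d) :=
        ⟨.dec k, .fetch hq, hd, by simpa using hb⟩
      have s2 : SimStep T B prj pr b (⟨none, v, q ::ₘ 0, L⟩, d) none (⟨none, v, 0, L⟩, d) :=
        ⟨.test 0, .discard (hacc q (by rw [htok]; simp)),
          ⟨rfl, fun k hk => absurd hk (Nat.not_lt_zero _)⟩, by simp⟩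
      exact ⟨c', L', hL', .head s1 (.head s2 hrun)⟩

/-- Any represented state can be fetched into the control. -/
theorem exists_run_fetch {p : Option Q} {v : P} {l Y : Multiset P} {L : K → Option P} {q : P}
    (hl : l.card + 1 ≤ b) (c : K → ℕ) (h : l + tokens L c = q ::ₘ Y) :
    ∃ l' c', LRun (SimStep T B prj pr b) (⟨p, v, l, L⟩, c) [] (⟨p, v, q ::ₘ l', L⟩, c') ∧
      l' + tokens L c' = Y ∧ l' ≤ l ∧ ∀ k, c' k ≠ 0 → c k ≠ 0 := by
  classical
  have hq : q ∈ l + tokens L c := by rw [h]; simp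
  rcases Multiset.mem_add.1 hq with hq | hq
  · obtain ⟨l', rfl⟩ := Multiset.exists_cons_of_mem hq
    refine ⟨l', c, .refl _, ?_, Multiset.le_cons_self l' q, fun _ => id⟩
    rwa [Multiset.cons_add, Multiset.cons_inj_right] at h
  · obtain ⟨k, hck, hk⟩ := mem_tokens.1 hq
    have hd := incAt_update_pred k c hck
    have s1 : SimStep T B prj pr b (⟨p, v, l, L⟩, c) none
        (⟨p, v, q ::ₘ l, L⟩, Function.update c k (c k - 1)) :=
      ⟨.dec k, .fetch hk, hd, by simpa using hl⟩
    refine ⟨l, _, .single s1, ?_, le_rfl, fun j hj => ?_⟩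
    · rwa [tokens_incAt hd hk, Multiset.add_cons, Multiset.cons_inj_right] at h
    · by_cases hjk : j = k
      · exact hjk ▸ hck
      · rwa [hd.2 j hjk]

end Moves

end Completeness

theorem countP_le_countP {α : Type*} {p q : α → Prop} [DecidablePred p] [DecidablePred q]
    (s : Multiset α) (h : ∀ x ∈ s, p x → q x) : s.countP p ≤ s.countP q := by
  induction s using Multiset.induction_on with
  | empty => simp
  | cons a s ih =>
    have ih := ih fun x hx => h x (Multiset.mem_cons_of_mem hx)
    have ha := h a (Multiset.mem_cons_self a s)
    rw [Multiset.countP_cons, Multiset.countP_cons]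
    split_ifs <;> first | omega | tauto

theorem filterMap_cons_eq {S A : Type*} (prj : S → Option A) (a : S) (w : List S) :
    (a :: w).filterMap prj = (prj a).toList ++ w.filterMap prj := by
  cases h : prj a <;> simp [h]

/-! ### Completeness of the simulating machine -/

section Completeness

variable {S A : Type*} {G Q P : Type}

/-- The configurations from which the simulating machine can process the outputs `w`. The counter
`(j, m, s)` is in use when `j` is the next rank greater than `m`; it then represents classes whose
state is settled for the ranks up to `m`. -/
structure SimInv (B : DFA (G × Bool) P) (rk : G → ℕ) (n : ℕ) (w : List G) (l : Multiset P)
    (L : Fin (n + 2) × Fin (n + 1) × P → Option P) (c : Fin (n + 2) × Fin (n + 1) × P → ℕ) :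
    Prop where
  unlabelled : ∀ k, (k.1 : ℕ) ≠ nextRank rk (n + 1) w k.2.1 → L k = none
  surj : ∀ (m : Fin (n + 1)) (q : P), Settled B rk m q → ∃ k, k.2.1 = m ∧ L k = some q
  settled : ∀ k, c k ≠ 0 → ∃ q, L k = some q ∧ Settled B rk k.2.1 q
  transient : ∀ q ∈ l, ¬ ZeroCyclic B q
  count : ∀ a, 1 ≤ a → l.countP (fun q => a ≤ zeroHeight B q) ≤ Nat.card P + 1 - a

variable {B : DFA (G × Bool) P} {rk : G → ℕ} {n : ℕ}

theorem SimInv.card_le [Finite P] {w : List G} {l : Multiset P}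
    {L : Fin (n + 2) × Fin (n + 1) × P → Option P} {c : Fin (n + 2) × Fin (n + 1) × P → ℕ}
    (h : SimInv B rk n w l L c) : l.card ≤ Nat.card P := by
  have := h.count 1 le_rfl
  rwa [Multiset.countP_eq_card.2 fun q _ => zeroHeight_pos q, Nat.add_sub_cancel] at this

open Classical in
-- The inductive step of completeness. The bound `Nat.card P + 2` leaves room for the held classes,
-- the class touched by the letter, and one unit in transit between counters.
theorem SimInv.letter [Fintype P] {T : Transducer S G Q} {prj : S → Option A}
    (hrk : ∀ γ, 1 ≤ rk γ) (hrn : ∀ γ, rk γ ≤ n)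
    (hpat : ∀ γ γ', HasPattern B γ γ' → rk γ < rk γ')
    {γ : G} {w : List G} {l : Multiset P}
    {L : Fin (n + 2) × Fin (n + 1) × P → Option P} {c : Fin (n + 2) × Fin (n + 1) × P → ℕ}
    (h : SimInv B rk n (γ :: w) l L c) {p p' : Q} {a : S} (ht : (p, a, γ, p') ∈ T.trans)
    {v q : P} {Y : Multiset P}
    (hq : q = v ∧ Y = l + tokens L c ∨ l + tokens L c = q ::ₘ Y) :
    ∃ l' L' c', LRun (SimStep T B prj (fun k => (k.1 : ℕ)) (Nat.card P + 2))
        (⟨some p, v, l, L⟩, c) (prj a).toList (⟨some p', B.step v (γ, false), l', L'⟩, c') ∧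
      SimInv B rk n w l' L' c' ∧ l' + tokens L' c' =
        B.step q (γ, true) ::ₘ Y.map fun p => B.step p (γ, false) := by
  have hcard := h.card_le
  set f : P → P := fun p => B.step p (γ, false) with hf
  set b := Nat.card P + 2 with hb
  set L₁ : Fin (n + 2) × Fin (n + 1) × P → Option P := fun k => (L k).map f with hL₁
  have hnext_lt : ∀ m, m < rk γ → nextRank rk (n + 1) (γ :: w) m = rk γ := fun m hm => if_pos hm
  have hnext_ge : ∀ m, rk γ ≤ m → nextRank rk (n + 1) (γ :: w) m = nextRank rk (n + 1) w m :=
    fun m hm => if_neg (not_lt.2 hm)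
  have hidx : ∀ m : Fin (n + 1), nextRank rk (n + 1) w m < n + 2 := fun m =>
    Nat.lt_succ_of_le (nextRank_le (fun γ => (hrn γ).trans (Nat.le_succ n)) m w)
  have hL₁none : ∀ k, L₁ k ≠ none → (k.1 : ℕ) = nextRank rk (n + 1) (γ :: w) k.2.1 := by
    intro k hk
    by_contra hc
    exact hk (by simp [hL₁, h.unlabelled k hc])
  have hsurj : ∀ (m : Fin (n + 1)) (r : P), rk γ ≤ m → Settled B rk m r →
      ∃ k, k.2.1 = m ∧ L₁ k = some r := by
    intro m r hm hr
    obtain ⟨r', hr', rfl⟩ := hr.exists_step_eq hm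
    obtain ⟨k, hk, hkr⟩ := h.surj m r' hr'
    exact ⟨k, hk, by simp [hL₁, hkr, hf]⟩
  -- the letter is read
  obtain ⟨l₁, c₁, hrun₁, htok₁, hl₁, hc₁⟩ : ∃ l₁ c₁,
      LRun (SimStep T B prj (fun k => (k.1 : ℕ)) b) (⟨some p, v, l, L⟩, c) (prj a).toList
        (⟨some p', f v, B.step q (γ, true) ::ₘ l₁.map f, L₁⟩, c₁) ∧
      l₁ + tokens L c₁ = Y ∧ l₁ ≤ l ∧ ∀ k, c₁ k ≠ 0 → c k ≠ 0 := by
    rcases hq with ⟨rfl, rfl⟩ | hq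
    · refine ⟨l, c, .single ⟨.test 0, .letter ht (Or.inl ⟨rfl, rfl⟩), ⟨rfl, by simp⟩, ?_⟩, rfl,
        le_rfl, fun _ => id⟩
      simp only [Multiset.card_cons, Multiset.card_map]
      omega
    · obtain ⟨l₁, c₁, hrun, htok, hl, hc⟩ := exists_run_fetch (T := T) (B := B) (prj := prj)
        (pr := fun k => (k.1 : ℕ)) (b := b) (p := some p) (v := v) (by omega) c hq
      refine ⟨l₁, c₁, ?_, htok, hl, hc⟩
      refine hrun.trans (.single ⟨.test 0, .letter ht (Or.inr rfl), ⟨rfl, by simp⟩, ?_⟩)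
      have := Multiset.card_le_card hl
      simp only [Multiset.card_cons, Multiset.card_map]
      omega
  set l₂ := B.step q (γ, true) ::ₘ l₁.map f with hl₂
  have hl₂card : l₂.card + 1 ≤ b := by
    have := Multiset.card_le_card hl₁
    simp only [hl₂, Multiset.card_cons, Multiset.card_map]
    omega
  have htok₂ : l₂ + tokens L₁ c₁ = B.step q (γ, true) ::ₘ Y.map f := by
    rw [hl₂, hL₁, tokens_map, Multiset.cons_add, ← Multiset.map_add, htok₁]
  -- the classes of lower levels move to the level of the letter
  obtain ⟨c₂, hrun₂, htokc₂, hc₂⟩ := exists_run_transfer (T := T) (B := B) (prj := prj)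
    (pr := fun k => (k.1 : ℕ)) (b := b) (p := some p') (v := f v) (l := l₂) (L := L₁) hl₂card
    (fun k => (k.2.1 : ℕ) < rk γ) (fun k => ∃ q, L₁ k = some q ∧ Settled B rk k.2.1 q) c₁
    (by
      intro k hk hck
      obtain ⟨r, hr, hr'⟩ := h.settled k (hc₁ k hck)
      exact ⟨f r, by simp [hL₁, hr], hr'.step (not_lt.1 hk)⟩)
    (by
      intro k hk hck
      obtain ⟨r, hr, hr'⟩ := h.settled k (hc₁ k hck)
      -- A class of lower level is at least `0`-cyclic, so reading `γ` settles it for the rank of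
      -- `γ`; a counter of that level with the required label exists by `hsurj`.
      have hs := hr'.1.settled_step hpat γ
      obtain ⟨k', hk', hkr⟩ := hsurj ⟨rk γ, Nat.lt_succ_of_le (hrn γ)⟩ _ le_rfl hs
      refine ⟨f r, k', ?_, by simp [hL₁, hr], hkr, _, hkr, ?_⟩
      · rw [hk']; simp
      · rw [hk']; exact hs)
  -- the meaning of the lower counters is set anew
  set L₂ : Fin (n + 2) × Fin (n + 1) × P → Option P := fun k =>
    if (k.2.1 : ℕ) < rk γ then
      if (k.1 : ℕ) = nextRank rk (n + 1) w k.2.1 then some k.2.2 else none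
    else L₁ k with hL₂
  have hrun₃ : SimStep T B prj (fun k => (k.1 : ℕ)) b (⟨some p', f v, l₂, L₁⟩, c₂) none
      (⟨some p', f v, l₂, L₂⟩, c₂) := by
    refine ⟨.test (rk γ + 1), .reset fun k hk hne => ?_, ⟨rfl, fun k hk => ?_⟩, ?_⟩
    -- A labelled counter of level below `rk γ` has priority exactly `rk γ`, the next rank to occur,
    -- so it is among the tested ones.
    · refine if_neg fun hlt => ?_
      have := hL₁none k hne
      rw [hnext_lt _ hlt] at this
      omega
    -- After the transfer a nonzero counter has level `m ≥ rk γ`, hence its priority, the next rank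
    -- above `m`, exceeds `rk γ` and is not tested.
    · by_contra hck
      obtain ⟨hZ, r, hr, -⟩ := hc₂ k hck
      have h1 := hL₁none k (by rw [hr]; simp)
      rw [hnext_ge _ (not_lt.1 hZ)] at h1
      have h2 := lt_nextRank (rk := rk) k.2.1.isLt w
      have h3 : (k.1 : ℕ) < rk γ + 1 := hk
      omega
    · dsimp only
      omega
  have hL₂eq : ∀ k, c₂ k ≠ 0 → L₁ k = L₂ k := fun k hk => (if_neg (hc₂ k hk).1).symm
  have hnew : ∀ (m : Fin (n + 1)) (r : P), (m : ℕ) < rk γ →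
      L₂ (⟨nextRank rk (n + 1) w m, hidx m⟩, m, r) = some r := by
    intro m r hm
    simp [hL₂, hm]
  -- the held states that are `0`-cyclic are stored
  obtain ⟨c₃, hrun₄, htokc₃, hc₃⟩ := exists_run_store (T := T) (B := B) (prj := prj)
    (pr := fun k => (k.1 : ℕ)) (b := b) (p := some p') (v := f v)
    (l := l₂.filter fun q => ¬ ZeroCyclic B q) (L := L₂)
    (fun k => ∃ q, L₂ k = some q ∧ Settled B rk k.2.1 q) (l₂.filter (ZeroCyclic B))
    (by rw [Multiset.filter_add_not]; omega) c₂
    (by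
      intro k hk
      rw [← hL₂eq k hk]
      exact (hc₂ k hk).2)
    (by
      intro r hr
      have hr' := (Multiset.mem_filter.1 hr).2
      -- Level `0` lies below all ranks, so it was just labelled afresh with all states, and every
      -- `0`-cyclic state is settled for it.
      have := hnew 0 r (hrk γ)
      exact ⟨_, this, _, this, hr'.settled hrk⟩)
  rw [Multiset.filter_add_not] at hrun₄
  refine ⟨l₂.filter fun q => ¬ ZeroCyclic B q, L₂, c₃, ?_, ?_, ?_⟩
  · simpa using hrun₁.trans (hrun₂.trans ((LRun.single hrun₃).trans hrun₄))
  · refine ⟨fun k hk => ?_, fun m r hr => ?_, hc₃, fun r hr => (Multiset.mem_filter.1 hr).2,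
      fun a ha => ?_⟩
    · by_cases hlt : (k.2.1 : ℕ) < rk γ
      · simp only [hL₂, if_pos hlt, if_neg hk]
      · simp only [hL₂, if_neg hlt]
        by_contra hne
        exact hk (by rw [hL₁none k hne, hnext_ge _ (not_lt.1 hlt)])
    · by_cases hlt : (m : ℕ) < rk γ
      · exact ⟨_, rfl, hnew m r hlt⟩
      · obtain ⟨k, hk, hkr⟩ := hsurj m r (not_lt.1 hlt) hr
        refine ⟨k, hk, ?_⟩
        rw [← hkr]
        exact if_neg (by rwa [hk])
    · refine (Multiset.countP_le_of_le _ (Multiset.filter_le _ _)).trans ?_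
      -- Untouched held classes had height at least `a + 1` before the letter. The touched class
      -- adds at most one, and only if `a ≤ Nat.card P`.
      have h1 : (l₁.map f).countP (fun q => a ≤ zeroHeight B q) ≤ Nat.card P + 1 - (a + 1) := by
        refine le_trans ?_ (h.count (a + 1) (Nat.le_add_left 1 a))
        rw [Multiset.countP_map, ← Multiset.countP_eq_card_filter]
        refine (Multiset.countP_le_of_le _ hl₁).trans (countP_le_countP l fun r hr har => ?_)
        exact lt_of_le_of_lt har (zeroHeight_step_lt (h.transient r hr) γ)
      have h2 := zeroHeight_le (B := B) (B.step q (γ, true))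
      rw [hl₂, Multiset.countP_cons]
      split_ifs <;> omega
  · rw [htokc₃, ← tokens_congr hL₂eq, htokc₂, ← htok₂, ← add_assoc, add_comm (Multiset.filter _ _),
      Multiset.filter_add_not]

theorem SimInv.exists_run [Fintype P] {T : Transducer S G Q} {prj : S → Option A}
    (hrk : ∀ γ, 1 ≤ rk γ) (hrn : ∀ γ, rk γ ≤ n)
    (hpat : ∀ γ γ', HasPattern B γ γ' → rk γ < rk γ') :
    ∀ (w : List S) (w' : List G) {l : Multiset P}
      {L : Fin (n + 2) × Fin (n + 1) × P → Option P} {c : Fin (n + 2) × Fin (n + 1) × P → ℕ}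
      {p : Q} {v : P}, SimInv B rk n w' l L c → T.Produces p w w' →
      ClassRun B v (l + tokens L c) w' → (w = [] → l + tokens L c ≠ 0) →
      ∃ v' L' c', (∀ k, L' k = none) ∧
        LRun (SimStep T B prj (fun k => (k.1 : ℕ)) (Nat.card P + 2)) (⟨some p, v, l, L⟩, c)
          (w.filterMap prj) (⟨none, v', 0, L'⟩, c')
  | [], [], l, L, c, p, v, h, hT, hC, hne => by
    -- The move `finish` requires a class in the control as evidence that the data word is nonempty,
    -- so one is fetched.
    obtain ⟨q, hq⟩ := Multiset.exists_mem_of_ne_zero (hne rfl)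
    obtain ⟨Y, hY⟩ := Multiset.exists_cons_of_mem hq
    have hcard := h.card_le
    obtain ⟨l₁, c₁, hrun, htok, hl, hc⟩ := exists_run_fetch (T := T) (B := B) (prj := prj)
      (pr := fun k => (k.1 : ℕ)) (b := Nat.card P + 2) (p := some p) (v := v) (by omega) c hY
    have hcard₁ := Multiset.card_le_card hl
    have hfin : SimStep T B prj (fun k => (k.1 : ℕ)) (Nat.card P + 2)
        (⟨some p, v, q ::ₘ l₁, L⟩, c₁) none (⟨none, v, q ::ₘ l₁, L⟩, c₁) :=
      ⟨.test 0, .finish hT (Multiset.cons_ne_zero), ⟨rfl, by simp⟩, by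
        simp only [Multiset.card_cons]
        omega⟩
    obtain ⟨c', L', hL', hrun'⟩ := exists_run_discard (T := T) (B := B) (prj := prj)
      (pr := fun k : Fin (n + 2) × Fin (n + 1) × P => (k.1 : ℕ)) (b := Nat.card P + 2) (v := v)
      (by omega) (n + 2) (fun k => k.1.isLt) (q ::ₘ l₁) c₁ (by
        simp only [Multiset.card_cons]
        omega) (L := L)
      (fun k hk => by
        obtain ⟨r, hr, -⟩ := h.settled k (hc k hk)
        rw [hr]
        simp)
      (by
        rw [Multiset.cons_add, htok, ← hY]
        exact hC)
    exact ⟨v, L', c', hL', hrun.trans ((LRun.single hfin).trans hrun')⟩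
  | [], _ :: _, _, _, _, _, _, _, hT, _, _ => by simp [Transducer.Produces] at hT
  | _ :: _, [], _, _, _, _, _, _, hT, _, _ => by simp [Transducer.Produces] at hT
  | a :: w, γ :: w', l, L, c, p, v, h, hT, hC, _ => by
    obtain ⟨p', ht, hT⟩ := hT
    obtain ⟨q, Y, hq, hC⟩ := hC
    obtain ⟨l', L', c', hrun, hinv, htok⟩ := h.letter (prj := prj) hrk hrn hpat ht hq
    obtain ⟨v'', L'', c'', hL, hrun'⟩ := SimInv.exists_run (prj := prj) hrk hrn hpat w w' hinv hT
      (by rwa [htok]) (fun _ => by rw [htok]; exact Multiset.cons_ne_zero)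
    refine ⟨v'', L'', c'', hL, ?_⟩
    rw [filterMap_cons_eq]
    exact hrun.trans hrun'

/-- Initially no counter has a label, so any labelling may be chosen without a real test. The
machine guesses for each level the first higher rank in `w`. -/
theorem exists_initial_step [Fintype P] {T : Transducer S G Q} {prj : S → Option A}
    (hrn : ∀ γ, rk γ ≤ n) (w : List G) :
    ∃ L, SimInv B rk n w 0 L 0 ∧ SimStep T B prj (fun k => (k.1 : ℕ)) (Nat.card P + 2)
      (⟨some T.start, B.start, 0, fun _ => none⟩, 0) none (⟨some T.start, B.start, 0, L⟩, 0) := by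
  refine ⟨fun k => if (k.1 : ℕ) = nextRank rk (n + 1) w k.2.1 then some k.2.2 else none,
    ⟨fun k hk => if_neg hk, fun m q _ => ⟨(⟨nextRank rk (n + 1) w m, ?_⟩, m, q), rfl, if_pos rfl⟩,
      fun k hk => absurd rfl hk, by simp, by simp⟩,
    .test 0, .reset fun k _ hk => absurd rfl hk, ⟨rfl, by simp⟩, by simp⟩
  exact Nat.lt_succ_of_le (nextRank_le (fun γ => (hrn γ).trans (Nat.le_succ n)) m w)

theorem classLanguage_mem_machineLanguages [Finite Q] [Finite P] (T : Transducer S G Q)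
    (B : DFA (G × Bool) P) (prj : S → Option A) (hB : IsZeroPriority B) :
    classLanguage T B prj ∈ machineLanguages A := by
  have := Fintype.ofFinite P
  obtain ⟨n, e, he⟩ := hB
  -- Ranks start at `1`, which leaves level `0` for `0`-cyclic states about which nothing more is
  -- known.
  let rk : G → ℕ := fun γ => e.symm γ + 1
  have hrk : ∀ γ, 1 ≤ rk γ := fun γ => Nat.le_add_left 1 _
  have hrn : ∀ γ, rk γ ≤ n := fun γ => (e.symm γ).isLt
  have hpat : ∀ γ γ', HasPattern B γ γ' → rk γ < rk γ' := by
    intro γ γ' h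
    by_contra hc
    refine he (e.symm γ) (e.symm γ') ?_ (by simpa using h)
    rw [Fin.le_def]
    simp only [rk] at hc
    omega
  refine ⟨simulator T B prj (fun k : Fin (n + 2) × Fin (n + 1) × P => (k.1 : ℕ))
    (Nat.card P + 2), Set.Subset.antisymm (simulator_language_le T B prj _ _) ?_⟩
  rintro u ⟨w, w', hw, hT, hC, rfl⟩
  refine (mem_simulator_language _ _ _ _ _ _).2 ?_
  obtain ⟨L, hinv, hstep⟩ := exists_initial_step (B := B) (T := T) (prj := prj) hrn w'
  have h0 : (0 : Multiset P) + tokens L 0 = 0 := by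
    rw [tokens_eq_zero (c := 0) fun _ => rfl, add_zero]
  obtain ⟨v', L', c', hL', hrun⟩ := hinv.exists_run (prj := prj) hrk hrn hpat w w' hT
    (by rwa [h0]) (fun h => absurd h hw)
  exact ⟨v', L', c', hL', .head (σ := none) hstep hrun⟩

end Completeness

/-! ### The class condition that checks counter runs -/

section CounterClasses

/-- The states of the class condition for runs of a multicounter automaton: a data value that has
not occurred, one that is a unit of the counter `i`, one that is no longer used, and an error. -/
inductive UnitState (k : ℕ) where
  | unseen
  | unit (i : Fin k)
  | used
  | error

instance (k : ℕ) : Finite (UnitState k) :=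
  Finite.of_surjective (α := Fin k ⊕ Fin 3)
    (Sum.elim .unit ![.unseen, .used, .error]) (by
      rintro (_ | i | _ | _)
      · exact ⟨.inr 0, rfl⟩
      · exact ⟨.inl i, rfl⟩
      · exact ⟨.inr 1, rfl⟩
      · exact ⟨.inr 2, rfl⟩)

instance (k : ℕ) : Finite (Instr k) :=
  Finite.of_surjective (α := Fin k ⊕ Fin k ⊕ Fin k)
    (Sum.elim .inc (Sum.elim .dec .ifzLE)) (by
      rintro (i | i | i)
      · exact ⟨.inl i, rfl⟩
      · exact ⟨.inr (.inl i), rfl⟩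
      · exact ⟨.inr (.inr i), rfl⟩)

/-- The effect of an instruction at a position of another class. -/
def UnitState.idle {k : ℕ} : UnitState k → Option (Instr k) → UnitState k
  | .unit i, some (.ifzLE j) => if i ≤ j then .error else .unit i
  | p, _ => p

/-- The effect of an instruction at a position of the class. -/
def UnitState.touch {k : ℕ} : UnitState k → Option (Instr k) → UnitState k
  | .unseen, some (.inc i) => .unit i
  | .unseen, some (.dec _) => .error
  | .unseen, _ => .used
  | .unit i, some (.dec j) => if i = j then .used else .error
  | _, _ => .error

/-- The class condition for runs of a multicounter automaton: every data value is used for one unit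
of a counter or for a zero test, and no zero test is made while it is a unit of a tested counter. -/
def unitDFA (k : ℕ) : DFA (Option (Instr k) × Bool) (UnitState k) where
  step p a := if a.2 then p.touch a.1 else p.idle a.1
  start := .unseen
  accept := {p | p ≠ .error}

variable {k : ℕ}

/-- Zero tests come after all other instructions, in the order of their counters. -/
def testRank : Option (Instr k) → ℕ
  | some (.ifzLE j) => j + 1
  | _ => 0

theorem idle_eq_self {p : UnitState k} {γ : Option (Instr k)}
    (h : ∀ i j, p = .unit i → γ = some (.ifzLE j) → ¬ i ≤ j) : p.idle γ = p := by
  rcases p with _ | i | _ | _ <;> rcases γ with _ | i' | i' | j <;> try rfl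
  exact if_neg (h i j rfl rfl)

theorem idle_eq_self_or (p : UnitState k) (γ : Option (Instr k)) :
    p.idle γ = p ∨ p.idle γ = .error := by
  by_cases h : ∀ i j, p = .unit i → γ = some (.ifzLE j) → ¬ i ≤ j
  · exact Or.inl (idle_eq_self h)
  · push Not at h
    obtain ⟨i, j, rfl, rfl, hij⟩ := h
    exact Or.inr (if_pos hij)

/-- Only a live unit `i` under a test of a prefix containing `i` is acyclic. Letters with tag `0`
never create a live unit, so the whole path before it stays in `unit i`. Thus `γ` spares `i`: it is
either no test or a test of a shorter prefix. -/
theorem unitDFA_testRank_lt {γ γ' : Option (Instr k)} (h : HasPattern (unitDFA k) γ γ') :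
    testRank γ < testRank γ' := by
  obtain ⟨q₁, q₂, q₃, q₄, h12, h23, -, -, hc⟩ := h
  have hq₃ : q₃.idle γ' ≠ q₃ := fun hq => hc ⟨1, Nat.one_pos, hq⟩
  obtain ⟨i, j, rfl, rfl, hij⟩ : ∃ i j, q₃ = .unit i ∧ γ' = some (.ifzLE j) ∧ i ≤ j := by
    by_contra hcon
    push Not at hcon
    exact hq₃ (idle_eq_self fun i j h1 h2 => not_le.2 (hcon i j h1 h2))
  have hback : ∀ (p : UnitState k) γ, p.idle γ = UnitState.unit i → p = .unit i := by
    intro p γ hp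
    rcases idle_eq_self_or p γ with h | h
    · rw [← h, hp]
    · rw [h] at hp; cases hp
  have hq₂ : q₂ = .unit i := by
    refine Relation.ReflTransGen.head_induction_on h23 rfl ?_
    rintro a b ⟨γ₀, hγ₀⟩ - rfl
    exact hback a γ₀ hγ₀
  rw [hq₂] at h12
  obtain rfl := hback q₁ γ h12
  rcases γ with _ | i' | i' | j'
  · exact Nat.succ_pos _
  · exact Nat.succ_pos _
  · exact Nat.succ_pos _
  · have : ¬ i ≤ j' := fun hle => by
      have h1 : (UnitState.unit i).idle (some (.ifzLE j')) = .error := if_pos hle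
      have h2 : (UnitState.unit i).idle (some (.ifzLE j')) = .unit i := h12
      rw [h1] at h2
      cases h2
    have h1 : (j' : ℕ) < i := by simpa using this
    have h2 : (i : ℕ) ≤ j := hij
    simp only [testRank]
    omega

theorem not_classRun_of_error (w : List (Option (Instr k))) :
    ∀ (v : UnitState k) (X : Multiset (UnitState k)), .error ∈ X → ¬ ClassRun (unitDFA k) v X w := by
  induction w with
  | nil => exact fun v X hX h => h _ hX rfl
  | cons γ w ih =>
    rintro v X hX ⟨q, Y, hq, h⟩
    refine ih _ _ ?_ h
    have key : .error ∈ Y → (.error : UnitState k) ∈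
        (unitDFA k).step q (γ, true) ::ₘ Y.map fun p => (unitDFA k).step p (γ, false) := fun hY =>
      Multiset.mem_cons_of_mem (Multiset.mem_map.2 ⟨.error, hY, rfl⟩)
    rcases hq with ⟨-, rfl⟩ | rfl
    · exact key hX
    · rcases Multiset.mem_cons.1 hX with rfl | hY
      · rw [Multiset.mem_cons]
        left
        rcases γ with _ | _ | _ | _ <;> rfl
      · exact key hY

theorem idle_unseen (γ : Option (Instr k)) : (UnitState.unseen : UnitState k).idle γ = .unseen := by
  rcases γ with _ | _ | _ | _ <;> rfl

/-- A step of a class run without errors, with the idle classes unchanged. -/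
theorem classRun_unit_cons {γ : Option (Instr k)} {w : List (Option (Instr k))}
    {X : Multiset (UnitState k)} :
    ClassRun (unitDFA k) .unseen X (γ :: w) ↔ ∃ q Y, (q = .unseen ∧ Y = X ∨ X = q ::ₘ Y) ∧
      (∀ p ∈ Y, p.idle γ = p) ∧ q.touch γ ≠ .error ∧
      ClassRun (unitDFA k) .unseen (q.touch γ ::ₘ Y) w := by
  have hv : (unitDFA k).step .unseen (γ, false) = .unseen := idle_unseen γ
  have hmap : ∀ Y : Multiset (UnitState k), (∀ p ∈ Y, p.idle γ = p) →
      (Y.map fun p => (unitDFA k).step p (γ, false)) = Y := fun Y hY => by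
    conv_rhs => rw [← Multiset.map_id Y]
    exact Multiset.map_congr rfl hY
  constructor
  · rintro ⟨q, Y, hq, h⟩
    rw [hv] at h
    have hY : ∀ p ∈ Y, p.idle γ = p := fun p hp =>
      (idle_eq_self_or p γ).resolve_right fun he => not_classRun_of_error w _ _
        (Multiset.mem_cons_of_mem (Multiset.mem_map.2 ⟨p, hp, he⟩)) h
    rw [hmap Y hY] at h
    refine ⟨q, Y, hq, hY, fun he => not_classRun_of_error w _ _ ?_ h, h⟩
    rw [← he]
    exact Multiset.mem_cons_self _ _
  · rintro ⟨q, Y, hq, hY, -, h⟩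
    refine ⟨q, Y, hq, ?_⟩
    rw [hv, hmap Y hY]
    exact h

end CounterClasses

/-! ### Runs of a PMA as class runs -/

namespace PMA

variable {A : Type u} (M : PMA A)

/-- The transducer that reads the transitions of `M` along a run, after an additional letter, and
writes their instructions. -/
def runTransducer {B : Type} (f : B → A) :
    Transducer (Option (Option B × Instr M.k)) (Option (Instr M.k)) (Option M.State) where
  trans := {t | (t.1 = none ∧ t.2.1 = none ∧ t.2.2.1 = none ∧ t.2.2.2 = some M.start) ∨
    ∃ s σ l s', (s, σ.map f, l, s') ∈ M.trans ∧ t = (some s, some (σ, l), some l, some s')}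
  start := none
  accept := some '' M.accept

/-- The letter of `M` read by a transition. -/
def runProjection {B : Type} (f : B → A) (x : Option (Option B × Instr M.k)) : Option A :=
  x.bind fun y => y.1.map f

variable {M}

open Classical in
-- Counter `i` is the number of classes in state `unit i`. Without errors, an increment or a test
-- can touch only an unseen value, and a decrement of `i` only a live unit of `i`.
theorem exists_run_of_classRun {B : Type} (f : B → A) :
    ∀ (w : List (Option (Option B × Instr M.k))) (w' : List (Option (Instr M.k))) (s : M.State)
      (X : Multiset (UnitState M.k)), (M.runTransducer f).Produces (some s) w w' →
      ClassRun (unitDFA M.k) .unseen X w' → ∃ s' c, s' ∈ M.accept ∧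
        M.Run (s, fun i => X.count (.unit i)) (w.filterMap (M.runProjection f)) (s', c)
  | [], [], s, X, hT, _ => by
    obtain ⟨s', hs', h⟩ := hT
    cases h
    exact ⟨s, _, hs', .refl _⟩
  | [], _ :: _, _, _, hT, _ => by simp [Transducer.Produces] at hT
  | _ :: _, [], _, _, hT, _ => by simp [Transducer.Produces] at hT
  | a :: w, γ :: w', s, X, hT, hC => by
    obtain ⟨_, ht, hT⟩ := hT
    obtain ⟨q, Y, hq, hY, hne, hC⟩ := classRun_unit_cons.1 hC
    rcases ht with ⟨h, -⟩ | ⟨s₁, σ, l, s₂, hM, ht⟩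
    · cases h
    · cases ht
      obtain ⟨s', c, hs', hrun⟩ := exists_run_of_classRun f w w' s₂ _ hT hC
      refine ⟨s', c, hs', ?_⟩
      rw [filterMap_cons_eq]
      refine .step (l := l) ?_ hrun
      refine ⟨hM, ?_⟩
      have hunseen : q = .unseen → ∀ i, X.count (.unit i) = Y.count (.unit i) := by
        rintro rfl i
        rcases hq with ⟨-, rfl⟩ | rfl
        · rfl
        · rw [Multiset.count_cons_of_ne (by simp)]
      cases l with
      | inc i =>
        have hqu : q = .unseen := by
          rcases q with _ | _ | _ | _
          · rfl
          all_goals exact absurd rfl hne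
        have h1 := hunseen hqu
        subst hqu
        refine ⟨?_, fun j hj => ?_⟩
        · dsimp only
          rw [h1]
          exact Multiset.count_cons_self _ _
        · dsimp only
          rw [h1]
          exact Multiset.count_cons_of_ne (fun h => hj (by cases h; rfl)) _
      | dec i =>
        have hqu : q = .unit i := by
          rcases q with _ | j | _ | _
          · exact absurd rfl hne
          · by_cases hji : j = i
            · rw [hji]
            · exact absurd (if_neg hji) hne
          all_goals exact absurd rfl hne
        subst hqu
        have hX : X = .unit i ::ₘ Y := hq.resolve_left fun h => by cases h.1
        have htouch : (UnitState.unit i).touch (some (.dec i)) = .used := if_pos rfl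
        rw [htouch, hX]
        refine ⟨?_, ?_, fun j hj => ?_⟩
        · dsimp only
          rw [Multiset.count_cons_self]
          exact Nat.succ_pos _
        · dsimp only
          rw [Multiset.count_cons_self, Multiset.count_cons_of_ne (by simp)]
          rfl
        · dsimp only
          rw [Multiset.count_cons_of_ne (by simp),
            Multiset.count_cons_of_ne fun h => hj (by cases h; rfl)]
      | ifzLE i =>
        have hqu : q = .unseen := by
          rcases q with _ | _ | _ | _
          · rfl
          all_goals exact absurd rfl hne
        have h1 := hunseen hqu
        subst hqu
        refine ⟨fun j hj => ?_, fun j => ?_⟩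
        · dsimp only
          rw [h1, Multiset.count_eq_zero]
          intro hmem
          have h2 := hY _ hmem
          have h3 : (UnitState.unit j).idle (some (.ifzLE i)) = .error := if_pos hj
          rw [h3] at h2
          cases h2
        · dsimp only
          rw [h1]
          exact Multiset.count_cons_of_ne (by intro h; cases h) _

open Classical in
-- Increments and tests open a new class, and a decrement touches some live unit, which exists
-- because the counter is positive. Live units are accepted at the end, in keeping with the
-- arbitrary final counter values.
theorem exists_classRun_of_run {B : Type} (f : B ≃ A) {x y : M.State × (Fin M.k → ℕ)}
    {u : List A} (h : M.Run x u y) (hy : y.1 ∈ M.accept) (X : Multiset (UnitState M.k))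
    (hX : .error ∉ X) (hc : ∀ i, X.count (.unit i) = x.2 i) :
    ∃ w w', w.filterMap (M.runProjection f) = u ∧
      (M.runTransducer f).Produces (some x.1) w w' ∧ ClassRun (unitDFA M.k) .unseen X w' := by
  induction h generalizing X with
  | refl x => exact ⟨[], [], rfl, ⟨_, hy, rfl⟩, fun q hq h => hX (h ▸ hq)⟩
  | @step x y z σ l u hs _ ih =>
    obtain ⟨hM, hex⟩ := hs
    suffices hsuf : ∃ q Y, (q = .unseen ∧ Y = X ∨ X = q ::ₘ Y) ∧ (∀ p ∈ Y, p.idle (some l) = p) ∧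
        q.touch (some l) ≠ .error ∧ ∀ i, (q.touch (some l) ::ₘ Y).count (.unit i) = y.2 i by
      obtain ⟨q, Y, hq, hY, hne, hcount⟩ := hsuf
      obtain ⟨w, w', rfl, hT, hC⟩ := ih hy (q.touch (some l) ::ₘ Y) (by
        rw [Multiset.mem_cons, not_or]
        refine ⟨hne.symm, fun hmem => hX ?_⟩
        rcases hq with ⟨-, rfl⟩ | rfl
        · exact hmem
        · exact Multiset.mem_cons_of_mem hmem) hcount
      refine ⟨some (σ.map f.symm, l) :: w, some l :: w', ?_, ⟨some y.1, ?_, hT⟩,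
        classRun_unit_cons.2 ⟨q, Y, hq, hY, hne, hC⟩⟩
      · rw [filterMap_cons_eq]
        simp [runProjection]
      · exact Or.inr ⟨x.1, σ.map f.symm, l, y.1, by simpa using hM, rfl⟩
    cases l with
    | inc i =>
      refine ⟨.unseen, X, Or.inl ⟨rfl, rfl⟩, fun p _ => idle_eq_self (by simp),
        by simp [UnitState.touch], fun j => ?_⟩
      change Multiset.count _ (UnitState.unit i ::ₘ X) = _
      by_cases hj : j = i
      · rw [hj, Multiset.count_cons_self, hc, hex.1]
      · rw [Multiset.count_cons_of_ne (fun h => hj (by cases h; rfl)), hc, hex.2 j hj]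
    | dec i =>
      have hmem : .unit i ∈ X := by
        rw [← Multiset.count_pos, hc]
        exact hex.1
      obtain ⟨Y, rfl⟩ := Multiset.exists_cons_of_mem hmem
      have htouch : (UnitState.unit i).touch (some (.dec i)) = .used := if_pos rfl
      refine ⟨.unit i, Y, Or.inr rfl, fun p _ => idle_eq_self (by simp), by simp [htouch],
        fun j => ?_⟩
      rw [htouch, Multiset.count_cons_of_ne (by simp)]
      have := hc j
      by_cases hj : j = i
      · subst hj
        rw [Multiset.count_cons_self] at this
        rw [hex.2.1]
        omega
      · rw [Multiset.count_cons_of_ne (fun h => hj (by cases h; rfl))] at this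
        rw [hex.2.2 j hj, this]
    | ifzLE i =>
      refine ⟨.unseen, X, Or.inl ⟨rfl, rfl⟩, fun p hp => idle_eq_self ?_,
        by simp [UnitState.touch], fun j => ?_⟩
      · rintro j i' rfl hi hle
        cases hi
        have := hc j
        rw [hex.1 j hle, Multiset.count_eq_zero] at this
        exact this hp
      · change Multiset.count _ (UnitState.used ::ₘ X) = _
        rw [Multiset.count_cons_of_ne (by simp), hc, hex.2]

theorem classLanguage_runTransducer (M : PMA A) {B : Type} (f : B ≃ A) :
    classLanguage (M.runTransducer f) (unitDFA M.k) (M.runProjection f) = M.language := by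
  classical
  refine Set.Subset.antisymm ?_ ?_
  · rintro u ⟨w, w', hw, hT, hC, rfl⟩
    match w, w', hw, hT, hC with
    | a :: w, [], _, hT, _ => simp [Transducer.Produces] at hT
    | a :: w, γ :: w', _, hT, hC =>
      obtain ⟨q, ht, hT⟩ := hT
      rcases ht with ⟨-, ha, hγ, hq⟩ | ⟨_, _, _, _, -, ht⟩
      · dsimp only at ha hγ hq
        subst ha hγ hq
        obtain ⟨q, Y, hq, -, hne, hC⟩ := classRun_unit_cons.1 hC
        obtain ⟨rfl, rfl⟩ : q = .unseen ∧ Y = 0 :=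
          hq.resolve_right fun h => (Multiset.cons_ne_zero h.symm).elim
        obtain ⟨s, c, hs, hrun⟩ := exists_run_of_classRun f w w' M.start _ hT hC
        refine ⟨s, c, hs, ?_⟩
        have h0 : (fun i => Multiset.count (.unit i)
            ((UnitState.unseen : UnitState M.k).touch none ::ₘ 0)) = fun _ => 0 := by
          funext i
          change Multiset.count _ (UnitState.used ::ₘ 0) = _
          rw [Multiset.count_cons_of_ne (by simp), Multiset.count_zero]
        rw [h0] at hrun
        exact hrun
      · cases ht
  · rintro u ⟨s, c, hs, hrun⟩
    -- The class `used` belongs to the additional first letter, which makes the data word nonempty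
    -- even when the run has no transitions.
    obtain ⟨w, w', rfl, hT, hC⟩ := exists_classRun_of_run f hrun hs {.used} (by simp) (by
      intro i
      simp)
    refine ⟨none :: w, none :: w', by simp, ⟨_, Or.inl ⟨rfl, rfl, rfl, rfl⟩, hT⟩, ?_, rfl⟩
    exact classRun_unit_cons.2 ⟨.unseen, 0, Or.inl ⟨rfl, rfl⟩, by simp,
      by simp [UnitState.touch], hC⟩

end PMA

/-! ### From ranks to the priority class condition -/

section PatternTransfer

variable {G H P : Type}

theorem HasPattern.of_comap {B : DFA (G × Bool) P} (f : H → G) {γ₁ γ₂ : H}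
    (h : HasPattern (B.comap (Prod.map f id)) γ₁ γ₂) : HasPattern B (f γ₁) (f γ₂) := by
  have hstep : ∀ p q, ZeroStep (B.comap (Prod.map f id)) p q → ZeroStep B p q :=
    fun p q ⟨γ, hγ⟩ => ⟨f γ, hγ⟩
  obtain ⟨q₁, q₂, q₃, q₄, h12, h23, h34, h1, h3⟩ := h
  exact ⟨q₁, q₂, q₃, q₄, h12, Relation.ReflTransGen.mono hstep _ _ h23, h34,
    Relation.TransGen.mono hstep _ _ h1, h3⟩

/-- Letters of equal rank may be listed in any order, since a pattern strictly increases the rank.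
-/
theorem isZeroPriority_of_rank [Finite G] {B : DFA (G × Bool) P} (rk : G → ℕ)
    (h : ∀ γ γ', HasPattern B γ γ' → rk γ < rk γ') : IsZeroPriority B := by
  obtain ⟨n, e, he⟩ := exists_equiv_fin_monotone rk
  exact ⟨n, e, fun i j hij hp => absurd (h _ _ hp) (not_lt.2 (he hij))⟩

/-- A class condition given by one `0`-priority automaton is a priority class condition. -/
theorem isPCA_of_rank {S : Type*} {C : ClassAutomaton S} [Finite P] (B : DFA (C.Out × Bool) P)
    (hC : C.classCond.accepts = B.accepts) (rk : C.Out → ℕ)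
    (h : ∀ γ γ', HasPattern B γ γ' → rk γ < rk γ') : C.IsPCA := by
  have := C.finite_out
  let B' : DFA (↥(Set.univ : Set C.Out) × Bool) P := B.comap (Prod.map Subtype.val id)
  refine ⟨1, fun _ => Set.univ, fun _ => B'.accepts, le_rfl, fun i j hij =>
    absurd (Subsingleton.elim i j) hij, Set.iUnion_const _, fun _ => ⟨P, inferInstance, B', ?_, rfl⟩,
    ?_⟩
  · exact isZeroPriority_of_rank (fun γ => rk γ) fun γ γ' hp => h _ _ hp.of_comap
  · rw [hC, ciSup_const]
    have hB' : B'.accepts = List.map (Prod.map Subtype.val id) ⁻¹' B.accepts :=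
      DFA.accepts_comap _ _
    have hsurj : Function.Surjective (List.map (Prod.map Subtype.val id) :
        List (↥(Set.univ : Set C.Out) × Bool) → List (C.Out × Bool)) :=
      List.map_surjective_iff.2 (Function.Surjective.prodMap
        (fun γ => ⟨⟨γ, trivial⟩, rfl⟩) Function.surjective_id)
    exact (Set.image_preimage_eq B.accepts hsurj).symm.trans
      (congrArg (Set.image (List.map (Prod.map Subtype.val id))) hB'.symm)

end PatternTransfer

/-! ### The two inclusions -/

theorem pmaLanguages_subset_pcaProjections (A : Type u) [Finite A] (D : Type v) [Infinite D] :
    pmaLanguages A ⊆ pcaProjections A D := by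
  rintro _ ⟨M, rfl⟩
  -- Tag alphabets live in `Type`, while `A` may lie in any universe; its letters are therefore
  -- replaced by elements of `Fin n`.
  obtain ⟨n, ⟨f⟩⟩ := Finite.exists_equiv_fin A
  have := M.finite_state
  let C : ClassAutomaton (Option (Option (Fin n) × Instr M.k)) :=
    { Out := Option (Instr M.k)
      finite_out := inferInstance
      TState := Option M.State
      finite_tstate := inferInstance
      transducer := M.runTransducer f.symm
      CState := UnitState M.k
      finite_cstate := inferInstance
      classCond := (unitDFA M.k).toNFA }
  have hC : C.classCond.accepts = (unitDFA M.k).accepts := DFA.toNFA_correct _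
  refine ⟨_, inferInstance, C, M.runProjection f.symm,
    isPCA_of_rank (unitDFA M.k) hC testRank fun _ _ => unitDFA_testRank_lt, ?_⟩
  rw [← M.classLanguage_runTransducer f.symm]
  refine Set.ext fun x => (mem_classLanguage_iff (D := D) _ _ _ x).trans ?_
  rw [← hC]
  simp only [Set.mem_image, ClassAutomaton.dataLanguage, Set.mem_ofPred_eq, and_assoc]
  rfl

theorem pcaProjections_subset_pmaLanguages (A : Type u) (D : Type v) [Infinite D] :
    pcaProjections A D ⊆ pmaLanguages A := by
  rintro _ ⟨S, _, C, prj, ⟨k, Γ, L, -, hdisj, -, hL, hC⟩, rfl⟩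
  have := C.finite_tstate
  choose P hP B hB hBL using hL
  simp only [← hBL] at hC
  rw [projections_eq_iSup C prj B hdisj hC]
  exact iSup_mem_pmaLanguages _ fun i =>
    have := hP i
    classLanguage_mem_machineLanguages _ _ prj (hB i)

end PriorityClass

theorem mainTheorem1 (A : Type*) [Finite A] (D : Type*) [Infinite D] :
    PriorityClass.pcaProjections A D = PriorityClass.pmaLanguages A :=
  Set.Subset.antisymm (PriorityClass.pcaProjections_subset_pmaLanguages A D)
    (PriorityClass.pmaLanguages_subset_pcaProjections A D)
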